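/- Let $\rho$ be a density matrix on $\mathbb C^D$ (positive semidefinite, $\operatorname{tr}\rho=1$) with an orthonormal eigenbasis $|s_1\rangle,\dots,|s_D\rangle$ and eigenvalues $\lambda_1,\dots,\lambda_D$. The Scrooge ensemble $\mathrm{Scrooge}[\rho]$ is the law of the unit vector $|\Phi\rangle=\sqrt\rho|\psi\rangle/\|\sqrt\rho|\psi\rangle\|$ when $|\psi\rangle$ is a Haar-random unit vector of $\mathbb C^D$ reweighted by the density $D\langle\psi|\rho|\psi\rangle$, and $\rho^{(k)}=\mathbb E_{\Phi}\big[(|\Phi\rangle\langle\Phi|)^{\otimes k}\big]$ is its $k$-th moment. For $\mathbf m=(m_1,\dots,m_k)\in\{1,\dots,D\}^k$ write $|\mathbf m\rangle=|s_{m_1}\rangle\otimes\cdots\otimes|s_{m_k}\rangle$. (i) For every $k$, $\langle\mathbf m|\rho^{(k)}|\mathbf m'\rangle\neq0$ only if $\mathbf m'$ is a permutation of $\mathbf m$, and for such $\mathbf m'$ one has $\langle\mathbf m|\rho^{(k)}|\mathbf m'\rangle=\langle\mathbf m|\rho^{(k)}|\mathbf m\rangle=:\rho^{(k)}_{\mathbf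 m}$. (ii) Let $k\ge2$ and let $\rho$ be positive definite. If the eigenvalues $\lambda_i$ are pairwise distinct, then $$\rho^{(k)}_{\mathbf m}=\frac{(-1)^D}{(k-2)!}\Big(\prod_{i=1}^D\lambda_i^{-1}\Big)\frac{\partial^k\Lambda_k}{\partial\mu_{m_1}\cdots\partial\mu_{m_k}}\bigg|_{\mu_i=\lambda_i^{-1}},\qquad \Lambda_k(\mu_1,\dots,\mu_D)=\sum_{j=1}^D\frac{\mu_j^{k-2}\ln\mu_j}{\prod_{i\ne j}(\mu_j-\mu_i)}.$$ If some eigenvalues coincide, the same holds with the value at $\mu_i=\lambda_i^{-1}$ replaced by the limit as $\mu\to(\lambda_1^{-1},\dots,\lambda_D^{-1})$ through points with pairwise distinct coordinates (this limit exists). (iii) There is an absolute constant $C$ such that for every $D$ and every density matrix $\rho$ on $\mathbb C^D$, $$\big\|\rho^{(2)}-\rho^{\otimes2}(\mathbb I+\mathbb S)\big\|_1\le C\operatorname{tr}(\rho^2),$$ where $\mathbb S$ is the swap operator on $\mathbb C^D\otimes\mathbb C^D$ and $\|\cdot\|_1$ is the trace norm. That is, $\rho^{(2)}\approx\rho^{\otimes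 2}(\mathbb I+\mathbb S)$ when the purity $\operatorname{tr}(\rho^2)$ is small. -/

import Mathlib

open MeasureTheory Matrix Filter Topology
open scoped ComplexOrder MatrixOrder Nat

namespace Scrooge

noncomputable section

/-- The normalised vector `ψ / ‖ψ‖`, with the Euclidean norm (and `0` for `ψ = 0`). -/
def normalize {D : ℕ} (ψ : Fin D → ℂ) : Fin D → ℂ :=
  (((√(∑ i, ‖ψ i‖ ^ 2))⁻¹ : ℝ) : ℂ) • ψ

/-- The Gaussian ensemble on `ℂ^D`: density `∏ z, (D/π) exp (-D |ψ_z|²)` with respect to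
Lebesgue measure, that is, independent complex Gaussian components of variance `1/D`. -/
def gaussianEnsemble (D : ℕ) : Measure (Fin D → ℂ) :=
  (volume : Measure (Fin D → ℂ)).withDensity fun ψ =>
    ENNReal.ofReal (∏ z, ((D : ℝ) / Real.pi * Real.exp (-(D : ℝ) * ‖ψ z‖ ^ 2)))

/-- The Haar ensemble (the unitarily invariant probability measure on unit vectors of `ℂ^D`):
the law of a normalised Gaussian vector. -/
def haarEnsemble (D : ℕ) : Measure (Fin D → ℂ) :=
  (gaussianEnsemble D).map normalize

/-- A density matrix: positive semidefinite with unit trace. -/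
def IsDensityMatrix {D : ℕ} (ρ : Matrix (Fin D) (Fin D) ℂ) : Prop :=
  ρ.PosSemidef ∧ ρ.trace = 1

/-- The Scrooge ensemble of `ρ`: the law of `√ρ ψ / ‖√ρ ψ‖` when `ψ` is Haar-distributed
with the additional weight `D ⟨ψ|ρ|ψ⟩`. -/
def scrooge {D : ℕ} (ρ : Matrix (Fin D) (Fin D) ℂ) : Measure (Fin D → ℂ) :=
  ((haarEnsemble D).withDensity fun ψ =>
    ENNReal.ofReal ((D : ℝ) * (star ψ ⬝ᵥ (ρ *ᵥ ψ)).re)).map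
      fun ψ => normalize (CFC.sqrt ρ *ᵥ ψ)

/-- The `k`-th moment `∫ (|Φ⟩⟨Φ|)^{⊗k}` of an ensemble, as a matrix on `(ℂ^D)^{⊗k}`,
whose standard basis is indexed by `Fin k → Fin D`. -/
def kthMoment {D : ℕ} (E : Measure (Fin D → ℂ)) (k : ℕ) :
    Matrix (Fin k → Fin D) (Fin k → Fin D) ℂ :=
  Matrix.of fun a b => ∫ Φ, ∏ i, (Φ (a i) * star (Φ (b i))) ∂E

/-- The product vector `v 0 ⊗ ⋯ ⊗ v (k-1)` of `(ℂ^D)^{⊗k}`. -/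
def tensorKet {D k : ℕ} (v : Fin k → EuclideanSpace ℂ (Fin D)) : (Fin k → Fin D) → ℂ :=
  fun a => ∏ i, v i (a i)

/-- The matrix element `⟨s_{m_1},…,s_{m_k}| M |s_{m'_1},…,s_{m'_k}⟩` of an operator `M` on
`(ℂ^D)^{⊗k}` in the product basis built from `s`. -/
def matrixElement {D k : ℕ} (s : OrthonormalBasis (Fin D) ℂ (EuclideanSpace ℂ (Fin D)))
    (M : Matrix (Fin k → Fin D) (Fin k → Fin D) ℂ) (m m' : Fin k → Fin D) : ℂ :=
  star (tensorKet fun i => s (m i)) ⬝ᵥ (M *ᵥ tensorKet fun i => s (m' i))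

/-- `Λ_k(μ_1,…,μ_D) = ∑ j, μ_j^{k-2} ln μ_j / ∏_{i ≠ j} (μ_j - μ_i)`. -/
def Lam {D : ℕ} (k : ℕ) (μ : Fin D → ℝ) : ℝ :=
  ∑ j, μ j ^ ((k : ℤ) - 2) * Real.log (μ j) / ∏ i ∈ Finset.univ.erase j, (μ j - μ i)

/-- The partial derivative `∂F/∂μ_i`. -/
def partialDeriv {D : ℕ} (i : Fin D) (F : (Fin D → ℝ) → ℝ) : (Fin D → ℝ) → ℝ :=
  fun μ => deriv (fun t => F (Function.update μ i t)) (μ i)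

/-- The iterated partial derivative `∂^k F / ∂μ_{m_1} ⋯ ∂μ_{m_k}`. -/
def mixedPartial {D k : ℕ} (m : Fin k → Fin D) (F : (Fin D → ℝ) → ℝ) : (Fin D → ℝ) → ℝ :=
  (List.ofFn m).foldr partialDeriv F

/-- The tensor power `A^{⊗k}`. -/
def tensorPow {D : ℕ} (A : Matrix (Fin D) (Fin D) ℂ) (k : ℕ) :
    Matrix (Fin k → Fin D) (Fin k → Fin D) ℂ :=
  Matrix.of fun a b => ∏ i, A (a i) (b i)

/-- The swap operator on `(ℂ^D)^{⊗2}`, `|a,b⟩ ↦ |b,a⟩`. -/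
def swapOp (D : ℕ) : Matrix (Fin 2 → Fin D) (Fin 2 → Fin D) ℂ :=
  Matrix.of fun a b => if a = b ∘ Equiv.swap 0 1 then 1 else 0

/-- The trace norm `‖A‖₁ = tr √(A†A)`. -/
def traceNorm {n : Type*} [Fintype n] [DecidableEq n] (A : Matrix n n ℂ) : ℝ :=
  (CFC.sqrt (Aᴴ * A)).trace.re

end

end Scrooge

/-! Both sides of the closed form are identified with one integral, `resolventIntegral`, of `t^(k-2)
∏ n_i! / (μ_i + t)^(n_i + 1)` over `t > 0`, where `n_i` is the multiplicity of `i` in the tuple `m`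
and `μ_i = 1/λ_i`.

Moment side. Rotating by the eigenbasis reduces everything to `diagScrooge`, because the Gaussian
measure is unitarily invariant. That ensemble is invariant under diagonal phases, which forces part
(i). For a diagonal element, write `S z = ∑ λ_i |z_i|²` and let `Q z` be the product of the `λ_(m_i)
|z_(m_i)|²`; the integrand is `D S Q / S^k` divided by `‖z‖²`. The numerator is homogeneous of
degree two, so `lintegral_div_sqNorm` removes the `‖z‖²`. Writing `1 / S^(k-1)` as a Gamma integral
of `exp (-D S t)` makes the Gaussian integral a product over coordinates
(`lintegral_prod_norm_sq_diagScrooge`).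

Derivative side. `Λ_k` is the divided difference of `x^(k-2) log x` at the nodes `μ_i`. Replace `log
x` by `log (x + t)` and differentiate in `t`: the divided difference of `x^(k-2) / (x + t)` is a
polynomial of degree at most `k - 2` plus a constant multiple of `∏ 1 / (μ_i + t)`. The `k` partial
derivatives kill the polynomial and turn the product into the integrand above. Integrating over `t`
from `0` to `∞` gives `mixedPartial_Lam`. The integral is continuous at positive `μ`, also where
nodes coincide, hence the limit statement.

Second moment. In the product eigenbasis the error is `diag(c) (1 + S)` with swap-symmetric `c`, so
its trace norm is an explicit sum. The integral and `1 + x ≤ exp x` bound each moment entry from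
below; since the entries and the products `λ_i λ_j` both sum to 1, a one-sided estimate suffices and
yields the constant 8. -/

namespace Scrooge

/-! ### Iterated partial derivatives -/

section PartialDerivatives

variable {D : ℕ}

/-- Positive vectors with pairwise distinct coordinates. -/
def distinctPos (D : ℕ) : Set (Fin D → ℝ) := {μ | Function.Injective μ ∧ ∀ i, 0 < μ i}

lemma isOpen_setOf_injective : IsOpen {μ : Fin D → ℝ | Function.Injective μ} := by
  have : {μ : Fin D → ℝ | Function.Injective μ}
      = ⋂ i, ⋂ j, ⋂ (_ : i ≠ j), {μ : Fin D → ℝ | μ i ≠ μ j} := by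
    ext μ
    simp only [Set.mem_ofPred_eq, Set.mem_iInter, Function.Injective]
    exact ⟨fun h i j hij e => hij (h e), fun h i j e => by
      by_contra hij
      exact h i j hij e⟩
  rw [this]
  refine isOpen_iInter_of_finite fun i => isOpen_iInter_of_finite fun j =>
    isOpen_iInter_of_finite fun _ => ?_
  exact isOpen_ne_fun (continuous_apply i) (continuous_apply j)

lemma isOpen_setOf_pos : IsOpen {μ : Fin D → ℝ | ∀ i, 0 < μ i} := by
  simp only [Set.ofPred_forall]
  exact isOpen_iInter_of_finite fun i => isOpen_lt continuous_const (continuous_apply i)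

lemma isOpen_distinctPos : IsOpen (distinctPos D) :=
  isOpen_setOf_injective.inter isOpen_setOf_pos

lemma partialDeriv_eq {F : (Fin D → ℝ) → ℝ} {i : Fin D} {μ : Fin D → ℝ} {d : ℝ}
    (h : HasDerivAt (fun t => F (Function.update μ i t)) d (μ i)) : partialDeriv i F μ = d :=
  h.deriv

lemma eventually_update_mem {U : Set (Fin D → ℝ)} (hU : IsOpen U) {μ : Fin D → ℝ} (hμ : μ ∈ U)
    (i : Fin D) : ∀ᶠ t in 𝓝 (μ i), Function.update μ i t ∈ U := by
  have hc : Continuous fun t => Function.update μ i t := continuous_const.update i continuous_id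
  refine hc.continuousAt.eventually_mem ?_
  simpa using hU.mem_nhds hμ

lemma partialDeriv_congr {U : Set (Fin D → ℝ)} (hU : IsOpen U) {F G : (Fin D → ℝ) → ℝ}
    (h : ∀ μ ∈ U, F μ = G μ) (i : Fin D) {μ : Fin D → ℝ} (hμ : μ ∈ U) :
    partialDeriv i F μ = partialDeriv i G μ := by
  refine Filter.EventuallyEq.deriv_eq ?_
  filter_upwards [eventually_update_mem hU hμ i] with t ht using h _ ht

lemma foldr_partialDeriv_congr {U : Set (Fin D → ℝ)} (hU : IsOpen U) {F G : (Fin D → ℝ) → ℝ}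
    (h : ∀ μ ∈ U, F μ = G μ) (l : List (Fin D)) :
    ∀ μ ∈ U, l.foldr partialDeriv F μ = l.foldr partialDeriv G μ := by
  induction l with
  | nil => exact h
  | cons i l ih => exact fun μ hμ => partialDeriv_congr hU ih i hμ

/-- Polynomial functions of total degree at most `n`. -/
inductive IsPolyOfDegreeLE : ℕ → ((Fin D → ℝ) → ℝ) → Prop
  | const (n : ℕ) (c : ℝ) : IsPolyOfDegreeLE n fun _ => c
  | add {n : ℕ} {F G : (Fin D → ℝ) → ℝ} : IsPolyOfDegreeLE n F → IsPolyOfDegreeLE n G →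
      IsPolyOfDegreeLE n fun μ => F μ + G μ
  | coord_mul {n : ℕ} {F : (Fin D → ℝ) → ℝ} (i : Fin D) : IsPolyOfDegreeLE n F →
      IsPolyOfDegreeLE (n + 1) fun μ => μ i * F μ

lemma IsPolyOfDegreeLE.succ {n : ℕ} {F : (Fin D → ℝ) → ℝ} (h : IsPolyOfDegreeLE n F) :
    IsPolyOfDegreeLE (n + 1) F := by
  induction h with
  | const n c => exact .const _ c
  | add _ _ h1 h2 => exact .add h1 h2
  | coord_mul i _ h => exact .coord_mul i h

lemma IsPolyOfDegreeLE.const_mul {n : ℕ} {F : (Fin D → ℝ) → ℝ} (h : IsPolyOfDegreeLE n F)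
    (a : ℝ) : IsPolyOfDegreeLE n fun μ => a * F μ := by
  induction h with
  | const n c => exact .const _ (a * c)
  | add _ _ h1 h2 => simpa only [mul_add] using h1.add h2
  | coord_mul i _ h => simpa only [mul_left_comm] using h.coord_mul i

lemma hasDerivAt_update_apply (μ : Fin D → ℝ) (i j : Fin D) :
    HasDerivAt (fun t => Function.update μ i t j) (if j = i then 1 else 0) (μ i) := by
  by_cases h : j = i
  · subst h
    simpa using hasDerivAt_id' (μ j)
  · simpa [h] using hasDerivAt_const (μ i) (μ j)

/-- Truncated subtraction gives `0 - 1 = 0`, so the vanishing of the derivative of a degree-zero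
polynomial is recorded as a separate clause. -/
lemma IsPolyOfDegreeLE.exists_hasDerivAt {n : ℕ} {F : (Fin D → ℝ) → ℝ}
    (h : IsPolyOfDegreeLE n F) (i : Fin D) :
    ∃ G : (Fin D → ℝ) → ℝ, IsPolyOfDegreeLE (n - 1) G ∧ (n = 0 → ∀ μ, G μ = 0) ∧
      ∀ μ, HasDerivAt (fun t => F (Function.update μ i t)) (G μ) (μ i) := by
  induction h with
  | const n c => exact ⟨fun _ => 0, .const _ 0, fun _ _ => rfl, fun μ => hasDerivAt_const _ _⟩
  | add _ _ h1 h2 =>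
    obtain ⟨G1, a1, b1, c1⟩ := h1
    obtain ⟨G2, a2, b2, c2⟩ := h2
    exact ⟨_, a1.add a2, fun h μ => by simp [b1 h, b2 h], fun μ => (c1 μ).add (c2 μ)⟩
  | @coord_mul n F j hF h =>
    obtain ⟨G, a, b, c⟩ := h
    refine ⟨fun μ => (if j = i then 1 else 0) * F μ + μ j * G μ, ?_, by simp, fun μ => ?_⟩
    · refine (hF.const_mul _).add ?_
      rcases n with _ | n
      · simpa [b rfl] using IsPolyOfDegreeLE.const 0 0
      · exact a.coord_mul j
    · have h := (hasDerivAt_update_apply μ i j).mul (c μ)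
      rw [Function.update_eq_self] at h
      exact h

lemma hasDerivAt_prod_update {g : ℕ → ℝ → ℝ} {μ : Fin D → ℝ} {n : Fin D → ℕ} {i : Fin D}
    (hg : HasDerivAt (g (n i)) (g (n i + 1) (μ i)) (μ i)) :
    HasDerivAt (fun t => ∏ j, g (n j) (Function.update μ i t j))
      (∏ j, g (n j + if i = j then 1 else 0) (μ j)) (μ i) := by
  have h1 : ∀ t, ∏ j, g (n j) (Function.update μ i t j)
      = g (n i) t * ∏ j ∈ Finset.univ.erase i, g (n j) (μ j) := by
    intro t
    rw [← Finset.mul_prod_erase _ _ (Finset.mem_univ i), Function.update_self]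
    congr 1
    refine Finset.prod_congr rfl fun j hj => ?_
    rw [Function.update_of_ne (Finset.ne_of_mem_erase hj)]
  have h2 : ∏ j, g (n j + if i = j then 1 else 0) (μ j)
      = g (n i + 1) (μ i) * ∏ j ∈ Finset.univ.erase i, g (n j) (μ j) := by
    rw [← Finset.mul_prod_erase _ _ (Finset.mem_univ i), if_pos rfl]
    congr 1
    refine Finset.prod_congr rfl fun j hj => ?_
    rw [if_neg (Finset.ne_of_mem_erase hj).symm, add_zero]
  simp_rw [h1]
  rw [h2]
  exact hg.mul_const _

/-- Each `∂_i` lowers the degree of the polynomial part and advances the `i`-th factor of the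
product by one derivative. With more derivatives than the degree, only the product survives. -/
lemma foldr_partialDeriv_poly_add_prod {g : ℕ → ℝ → ℝ}
    (hg : ∀ r x, 0 < x → HasDerivAt (g r) (g (r + 1) x) x) {n : ℕ} {P : (Fin D → ℝ) → ℝ}
    (hP : IsPolyOfDegreeLE n P) (κ : ℝ) (l : List (Fin D)) :
    ∃ Q : (Fin D → ℝ) → ℝ, IsPolyOfDegreeLE (n - l.length) Q ∧ (n < l.length → ∀ μ, Q μ = 0) ∧
      ∀ μ ∈ distinctPos D, l.foldr partialDeriv (fun μ => P μ + κ * ∏ i, g 0 (μ i)) μ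
        = Q μ + κ * ∏ i, g (l.count i) (μ i) := by
  induction l with
  | nil => exact ⟨P, hP, by simp, by simp⟩
  | cons i l ih =>
    obtain ⟨Q, h1, h2, h3⟩ := ih
    obtain ⟨G, a, b, c⟩ := h1.exists_hasDerivAt i
    refine ⟨G, by simpa [Nat.sub_sub] using a, fun h => b ?_, fun μ hμ => ?_⟩
    · simp only [List.length_cons] at h
      omega
    · rw [List.foldr_cons, partialDeriv_congr isOpen_distinctPos h3 i hμ]
      refine partialDeriv_eq ?_
      simp only [List.count_cons, beq_iff_eq]
      exact (c μ).add ((hasDerivAt_prod_update (hg _ _ (hμ.2 i))).const_mul κ)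

/-- Operators `g ↦ ∑ c(μ) g⁽ʳ⁾(μ_j)` with smooth coefficients, acting on sequences of iterated
derivatives. -/
inductive IsJetOp : ((ℕ → ℝ → ℝ) → (Fin D → ℝ) → ℝ) → Prop
  | term (c : (Fin D → ℝ) → ℝ) (hc : ContDiffOn ℝ (⊤ : ℕ∞) c (distinctPos D)) (j : Fin D) (r : ℕ) :
      IsJetOp fun g μ => c μ * g r (μ j)
  | zero : IsJetOp fun _ _ => 0
  | add {S T : (ℕ → ℝ → ℝ) → (Fin D → ℝ) → ℝ} : IsJetOp S → IsJetOp T →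
      IsJetOp fun g μ => S g μ + T g μ

lemma IsJetOp.sum {ι : Type*} (s : Finset ι) {T : ι → (ℕ → ℝ → ℝ) → (Fin D → ℝ) → ℝ}
    (h : ∀ i, IsJetOp (T i)) : IsJetOp fun g μ => ∑ i ∈ s, T i g μ := by
  classical
  induction s using Finset.induction_on with
  | empty => simpa using IsJetOp.zero
  | insert i s hi ih => simpa only [Finset.sum_insert hi] using (h i).add ih

lemma IsJetOp.exists_hasDerivAt {T : (ℕ → ℝ → ℝ) → (Fin D → ℝ) → ℝ} (h : IsJetOp T) (i : Fin D) :
    ∃ T', IsJetOp T' ∧ ∀ g : ℕ → ℝ → ℝ, (∀ r x, 0 < x → HasDerivAt (g r) (g (r + 1) x) x) →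
      ∀ μ ∈ distinctPos D,
        HasDerivAt (fun t => T g (Function.update μ i t)) (T' g μ) (μ i) := by
  induction h with
  | zero => exact ⟨_, .zero, fun _ _ _ _ => hasDerivAt_const _ _⟩
  | add _ _ h1 h2 =>
    obtain ⟨S, a, b⟩ := h1
    obtain ⟨T, c, d⟩ := h2
    exact ⟨_, a.add c, fun g hg μ hμ => (b g hg μ hμ).add (d g hg μ hμ)⟩
  | term c hc j r =>
    have hc' : ContDiffOn ℝ (⊤ : ℕ∞) (fun μ => fderiv ℝ c μ (Pi.single i 1)) (distinctPos D) :=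
      (hc.fderiv_of_isOpen isOpen_distinctPos (by simp)).clm_apply contDiffOn_const
    have hd : ∀ μ ∈ distinctPos D, HasDerivAt (fun t => c (Function.update μ i t))
        (fderiv ℝ c μ (Pi.single i 1)) (μ i) := by
      intro μ hμ
      have h1 : DifferentiableAt ℝ c (Function.update μ i (μ i)) := by
        rw [Function.update_eq_self]
        exact (hc.differentiableOn (by simp)).differentiableAt (isOpen_distinctPos.mem_nhds hμ)
      have h2 := h1.hasFDerivAt.comp_hasDerivAt (μ i) (hasDerivAt_update μ i (μ i))
      rw [Function.update_eq_self] at h2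
      exact h2
    refine ⟨_, (IsJetOp.term _ hc' j r).add
      (.term (fun μ => (if j = i then 1 else 0) * c μ) (contDiffOn_const.mul hc) j (r + 1)),
      fun g hg μ hμ => ?_⟩
    have h2 : HasDerivAt (fun t => g r (Function.update μ i t j))
        (g (r + 1) (μ j) * if j = i then 1 else 0) (μ i) := by
      refine HasDerivAt.comp (h₂ := g r) (μ i) ?_ (hasDerivAt_update_apply μ i j)
      simpa using hg r (μ j) (hμ.2 j)
    convert! (hd μ hμ).mul h2 using 1
    simp

/-- The order of quantifiers is the point: one operator `T'` serves every `g`. For a family `g_t`,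
the `t`-derivative and the limit `t → ∞` can then be taken inside a fixed finite linear combination,
with no interchange of limits. -/
lemma IsJetOp.exists_foldr_partialDeriv {T : (ℕ → ℝ → ℝ) → (Fin D → ℝ) → ℝ} (h : IsJetOp T)
    (l : List (Fin D)) :
    ∃ T', IsJetOp T' ∧ ∀ g : ℕ → ℝ → ℝ, (∀ r x, 0 < x → HasDerivAt (g r) (g (r + 1) x) x) →
      ∀ μ ∈ distinctPos D, l.foldr partialDeriv (T g) μ = T' g μ := by
  induction l with
  | nil => exact ⟨T, h, fun _ _ _ _ => rfl⟩
  | cons i l ih =>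
    obtain ⟨S, a, b⟩ := ih
    obtain ⟨S', c, d⟩ := a.exists_hasDerivAt i
    refine ⟨S', c, fun g hg μ hμ => ?_⟩
    rw [List.foldr_cons, partialDeriv_congr isOpen_distinctPos (b g hg) i hμ]
    exact partialDeriv_eq (d g hg μ hμ)

lemma IsJetOp.map_sub_const_mul {T : (ℕ → ℝ → ℝ) → (Fin D → ℝ) → ℝ} (h : IsJetOp T)
    (g k : ℕ → ℝ → ℝ) (a : ℝ) (μ : Fin D → ℝ) :
    T (fun r x => g r x - a * k r x) μ = T g μ - a * T k μ := by
  induction h with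
  | zero => simp
  | add _ _ h1 h2 => simp only [h1, h2]; ring
  | term c hc j r => ring

lemma IsJetOp.tendsto_zero {T : (ℕ → ℝ → ℝ) → (Fin D → ℝ) → ℝ} (h : IsJetOp T)
    {g : ℝ → ℕ → ℝ → ℝ} (hg : ∀ r x, Tendsto (fun t => g t r x) atTop (𝓝 0)) (μ : Fin D → ℝ) :
    Tendsto (fun t => T (g t) μ) atTop (𝓝 0) := by
  induction h with
  | zero => simp
  | add _ _ h1 h2 => simpa using h1.add h2
  | term c hc j r => simpa using (hg r (μ j)).const_mul (c μ)

lemma IsJetOp.hasDerivAt_param {T : (ℕ → ℝ → ℝ) → (Fin D → ℝ) → ℝ} (h : IsJetOp T)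
    {g g' : ℝ → ℕ → ℝ → ℝ} {t : ℝ} {μ : Fin D → ℝ}
    (hg : ∀ r i, HasDerivAt (fun t => g t r (μ i)) (g' t r (μ i)) t) :
    HasDerivAt (fun t => T (g t) μ) (T (g' t) μ) t := by
  induction h with
  | zero => exact hasDerivAt_const _ _
  | add _ _ h1 h2 => exact h1.add h2
  | term c hc j r => exact (hg r j).const_mul (c μ)

end PartialDerivatives

/-! ### Divided differences -/

section DividedDifferences

variable {D : ℕ}

/-- The Lagrange basis polynomials sum to 1; compare the coefficients of degree `s.card - 1`. -/
lemma sum_inv_prod_sub (s : Finset (Fin D)) {μ : Fin D → ℝ} (hμ : Function.Injective μ) :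
    ∑ j ∈ s, (∏ i ∈ s.erase j, (μ j - μ i))⁻¹ = if s.card = 1 then 1 else 0 := by
  rcases s.eq_empty_or_nonempty with rfl | hs
  · simp
  have h := congrArg (fun p => p.coeff (s.card - 1)) (Lagrange.sum_basis (hμ.injOn (s := s)) hs)
  simp only [Polynomial.finsetSum_coeff, Polynomial.coeff_one] at h
  have h2 : ∀ j ∈ s, (Lagrange.basis s μ j).coeff (s.card - 1)
      = (∏ i ∈ s.erase j, (μ j - μ i))⁻¹ := by
    intro j hj
    rw [← Lagrange.leadingCoeff_basis hμ.injOn hj, Polynomial.leadingCoeff,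
      Lagrange.natDegree_basis hμ.injOn hj]
  rw [Finset.sum_congr rfl h2] at h
  rw [h]
  have := hs.card_pos
  congr 1
  simp only [eq_iff_iff]
  omega

/-- Induction on `a` by `μ_j = μ_i + (μ_j - μ_i)` for a fixed node `i`: the second summand cancels
the factor of `i` in the denominator and leaves a divided difference over `s.erase i`. The degree
bound is crude but is below `k = a + 2`. -/
lemma exists_isPoly_sum_pow_div (a : ℕ) (s : Finset (Fin D)) :
    ∃ P : (Fin D → ℝ) → ℝ, IsPolyOfDegreeLE a P ∧ ∀ μ, Function.Injective μ →
      ∑ j ∈ s, μ j ^ a / ∏ i ∈ s.erase j, (μ j - μ i) = P μ := by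
  induction a generalizing s with
  | zero =>
    refine ⟨_, .const 0 (if s.card = 1 then 1 else 0), fun μ hμ => ?_⟩
    simp only [pow_zero, one_div]
    exact sum_inv_prod_sub s hμ
  | succ a ih =>
    rcases s.eq_empty_or_nonempty with rfl | ⟨i, hi⟩
    · exact ⟨_, .const _ 0, by simp⟩
    obtain ⟨P, hP, hP'⟩ := ih (s.erase i)
    obtain ⟨Q, hQ, hQ'⟩ := ih s
    refine ⟨_, hP.succ.add (hQ.coord_mul i), fun μ hμ => ?_⟩
    rw [← hP' μ hμ, ← hQ' μ hμ, Finset.mul_sum, ← Finset.add_sum_erase s _ hi,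
      ← Finset.add_sum_erase s _ hi, add_left_comm, ← Finset.sum_add_distrib]
    congr 1
    · ring
    · refine Finset.sum_congr rfl fun j hj => ?_
      have hji : j ≠ i := Finset.ne_of_mem_erase hj
      have h0 : μ j - μ i ≠ 0 := sub_ne_zero.2 (hμ.ne hji)
      rw [← Finset.mul_prod_erase (s.erase j) _ (Finset.mem_erase.2 ⟨hji.symm, hi⟩),
        Finset.erase_right_comm]
      have h1 : ∏ x ∈ (s.erase i).erase j, (μ j - μ x) ≠ 0 := by
        refine Finset.prod_ne_zero_iff.2 fun x hx => sub_ne_zero.2 (hμ.ne ?_)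
        exact (Finset.ne_of_mem_erase hx).symm
      field_simp
      ring

/-- Partial fractions: the barycentric formula for the interpolant of the constant 1, evaluated at
`-t`. -/
lemma sum_inv_prod_sub_mul_inv_add (hD : 0 < D) {μ : Fin D → ℝ} (hμ : Function.Injective μ)
    {t : ℝ} (ht : ∀ i, μ i + t ≠ 0) :
    ∑ j, (∏ i ∈ Finset.univ.erase j, (μ j - μ i))⁻¹ * (μ j + t)⁻¹
      = (-1) ^ (D - 1) * ∏ i, (μ i + t)⁻¹ := by
  have : NeZero D := ⟨hD.ne'⟩
  have hx : ∀ i ∈ (Finset.univ : Finset (Fin D)), -t ≠ μ i := fun i _ h => ht i (by linarith)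
  have h := Lagrange.eval_interpolate_not_at_node (v := μ) (1 : Fin D → ℝ) hx
  rw [Lagrange.interpolate_one hμ.injOn Finset.univ_nonempty, Polynomial.eval_one,
    Lagrange.eval_nodal] at h
  have e1 : ∀ j, Lagrange.nodalWeight Finset.univ μ j * (-t - μ j)⁻¹ * (1 : Fin D → ℝ) j
      = -((∏ i ∈ Finset.univ.erase j, (μ j - μ i))⁻¹ * (μ j + t)⁻¹) := by
    intro j
    rw [Lagrange.nodalWeight, Finset.prod_inv_distrib, show -t - μ j = -(μ j + t) by ring, inv_neg]
    simp
  have e2 : ∏ i, (-t - μ i) = (-1) ^ D * ∏ i, (μ i + t) := by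
    rw [show (-1 : ℝ) ^ D = ∏ _i : Fin D, (-1 : ℝ) by simp, ← Finset.prod_mul_distrib]
    exact Finset.prod_congr rfl fun i _ => by ring
  rw [Finset.sum_congr rfl fun j _ => e1 j, e2, Finset.sum_neg_distrib] at h
  have h0 : ∏ i, (μ i + t) ≠ 0 := Finset.prod_ne_zero_iff.2 fun i _ => ht i
  rw [Finset.prod_inv_distrib]
  obtain ⟨d, rfl⟩ : ∃ d, D = d + 1 := ⟨D - 1, by omega⟩
  rw [add_tsub_cancel_right]
  have hs : ((-1 : ℝ) ^ d) * (-1) ^ d = 1 := by rw [← mul_pow]; simp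
  rw [pow_succ] at h
  generalize ∑ j, (∏ i ∈ Finset.univ.erase j, (μ j - μ i))⁻¹ * (μ j + t)⁻¹ = A at h ⊢
  field_simp
  linear_combination (-1) ^ d * (-h) - (∏ i, (μ i + t)) * A * hs

/-- Induction on `a` through `x / (x + t) = 1 - t / (x + t)`: each power of `x` adds a polynomial
and multiplies the singular part by `-t`. -/
lemma exists_isPoly_sum_pow_div_add (hD : 0 < D) (a : ℕ) (t : ℝ) :
    ∃ P : (Fin D → ℝ) → ℝ, IsPolyOfDegreeLE a P ∧ ∀ μ, Function.Injective μ →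
      (∀ i, μ i + t ≠ 0) →
      ∑ j, μ j ^ a / (∏ i ∈ Finset.univ.erase j, (μ j - μ i)) * (μ j + t)⁻¹
        = P μ + (-t) ^ a * (-1) ^ (D - 1) * ∏ i, (μ i + t)⁻¹ := by
  induction a with
  | zero =>
    refine ⟨_, .const 0 0, fun μ hμ ht => ?_⟩
    simpa using sum_inv_prod_sub_mul_inv_add hD hμ ht
  | succ a ih =>
    obtain ⟨P, hP, hP'⟩ := ih
    obtain ⟨Q, hQ, hQ'⟩ := exists_isPoly_sum_pow_div a (Finset.univ : Finset (Fin D))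
    refine ⟨_, (hQ.add (hP.const_mul (-t))).succ, fun μ hμ ht => ?_⟩
    have e : ∀ j, μ j ^ (a + 1) / (∏ i ∈ Finset.univ.erase j, (μ j - μ i)) * (μ j + t)⁻¹
        = μ j ^ a / (∏ i ∈ Finset.univ.erase j, (μ j - μ i))
          + -t * (μ j ^ a / (∏ i ∈ Finset.univ.erase j, (μ j - μ i)) * (μ j + t)⁻¹) := by
      intro j
      have := ht j
      have h1 : ∏ x ∈ Finset.univ.erase j, (μ j - μ x) ≠ 0 := by
        refine Finset.prod_ne_zero_iff.2 fun x hx => sub_ne_zero.2 (hμ.ne ?_)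
        exact (Finset.ne_of_mem_erase hx).symm
      field_simp
      ring
    rw [Finset.sum_congr rfl fun j _ => e j, Finset.sum_add_distrib, ← Finset.mul_sum,
      hP' μ hμ ht, hQ' μ hμ]
    ring

end DividedDifferences

/-! ### The derivatives of `Λ_k` as an integral -/

section LamFormula

variable {D : ℕ}

/-- The iterated derivatives of `x ↦ (x + t)⁻¹`. -/
noncomputable def invSeq (t : ℝ) (r : ℕ) (x : ℝ) : ℝ := (-1) ^ r * r ! / (x + t) ^ (r + 1)

/-- The iterated derivatives of `x ↦ log (x + t)`. -/
noncomputable def logSeq (t : ℝ) : ℕ → ℝ → ℝ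
  | 0, x => Real.log (x + t)
  | r + 1, x => invSeq t r x

/-- The iterated derivatives of the constant function `1`. -/
noncomputable def oneSeq : ℕ → ℝ → ℝ
  | 0, _ => 1
  | _ + 1, _ => 0

lemma hasDerivAt_invSeq {t x : ℝ} (h : 0 < x + t) (r : ℕ) :
    HasDerivAt (invSeq t r) (invSeq t (r + 1) x) x := by
  have h1 : HasDerivAt (fun x => (x + t) ^ (r + 1)) (((r + 1 : ℕ) : ℝ) * (x + t) ^ r * 1) x := by
    simpa using ((hasDerivAt_id' x).add_const t).fun_pow (r + 1)
  have h2 := (h1.fun_inv (pow_ne_zero _ h.ne')).const_mul ((-1) ^ r * (r ! : ℝ))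
  unfold invSeq
  simp only [div_eq_mul_inv]
  convert! h2 using 1
  rw [Nat.factorial_succ]
  push_cast
  field_simp
  ring

lemma hasDerivAt_logSeq {t x : ℝ} (h : 0 < x + t) (r : ℕ) :
    HasDerivAt (logSeq t r) (logSeq t (r + 1) x) x := by
  rcases r with _ | r
  · have h2 := ((hasDerivAt_id' x).add_const t).log h.ne'
    have h3 : logSeq t 1 x = 1 / (x + t) := by simp [logSeq, invSeq]
    rw [h3]
    exact h2
  · exact hasDerivAt_invSeq h r

lemma hasDerivAt_oneSeq (x : ℝ) (r : ℕ) : HasDerivAt (oneSeq r) (oneSeq (r + 1) x) x := by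
  rcases r with _ | r <;> exact hasDerivAt_const _ _

/-- These functions depend on `x + t` only, so the derivative rule in `x` is also the rule in `t`.
-/
lemma logSeq_comm (t : ℝ) (r : ℕ) (x : ℝ) : logSeq t r x = logSeq x r t := by
  cases r <;> simp [logSeq, invSeq, add_comm]

lemma tendsto_logSeq (r : ℕ) (x : ℝ) :
    Tendsto (fun t => logSeq t r x - Real.log t * oneSeq r x) atTop (𝓝 0) := by
  have hx : Tendsto (fun t : ℝ => x + t) atTop atTop := tendsto_atTop_add_const_left _ _ tendsto_id
  rcases r with _ | r
  · simp only [logSeq, oneSeq, mul_one]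
    have h1 : Tendsto (fun t : ℝ => 1 + x / t) atTop (𝓝 1) := by
      simpa using (tendsto_const_nhds (x := x)).div_atTop tendsto_id |>.const_add 1
    have h2 := h1.log one_ne_zero
    rw [Real.log_one] at h2
    refine h2.congr' ?_
    filter_upwards [eventually_gt_atTop 0, hx.eventually_gt_atTop 0] with t ht ht'
    rw [← Real.log_div ht'.ne' ht.ne']
    congr 1
    field_simp
    ring
  · simp only [logSeq, oneSeq, mul_zero, sub_zero, invSeq]
    exact tendsto_const_nhds.div_atTop ((tendsto_pow_atTop (by simp)).comp hx)

/-- `∫₀^∞ t^a ∏ n_i! / (μ_i + t)^(n_i + 1) dt`. -/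
noncomputable def resolventIntegral (a : ℕ) (n : Fin D → ℕ) (μ : Fin D → ℝ) : ℝ :=
  ∫ t in Set.Ioi (0 : ℝ), t ^ a * ∏ i, ((n i)! / (μ i + t) ^ (n i + 1) : ℝ)

lemma contDiffOn_lagrangeCoeff (a : ℕ) (j : Fin D) :
    ContDiffOn ℝ (⊤ : ℕ∞) (fun μ : Fin D → ℝ => μ j ^ a / ∏ i ∈ Finset.univ.erase j, (μ j - μ i))
      (distinctPos D) := by
  refine ContDiffOn.div ?_ ?_ fun μ hμ => ?_
  · exact ((contDiff_apply ℝ ℝ j).pow a).contDiffOn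
  · refine (contDiff_prod fun i _ => ?_).contDiffOn
    exact (contDiff_apply ℝ ℝ j).sub (contDiff_apply ℝ ℝ i)
  · refine Finset.prod_ne_zero_iff.2 fun x hx => sub_ne_zero.2 (hμ.1.ne ?_)
    exact (Finset.ne_of_mem_erase hx).symm

lemma sum_count_ofFn {k : ℕ} (m : Fin k → Fin D) : ∑ i, (List.ofFn m).count i = k := by
  have := Multiset.sum_count_eq_card (s := Finset.univ) (m := ((List.ofFn m : List (Fin D)) : Multiset (Fin D)))
    (by simp)
  simpa using this

/-- Let `T g` be the mixed partial derivative of the divided difference of `x^a g(x)`. The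
fundamental theorem of calculus is applied to `t ↦ T (logSeq t) μ`, whose value at `0` is the
required derivative, whose derivative is `T (invSeq t) μ`, and which vanishes at infinity. -/
lemma mixedPartial_Lam (hD : 0 < D) (a : ℕ) (m : Fin (a + 2) → Fin D) {μ : Fin D → ℝ}
    (hμ : μ ∈ distinctPos D) :
    mixedPartial m (Lam (a + 2)) μ
      = (-1) ^ D * resolventIntegral a (fun i => (List.ofFn m).count i) μ := by
  set l := List.ofFn m with hl
  have hlen : l.length = a + 2 := by simp [hl]
  have hT0 : IsJetOp fun (g : ℕ → ℝ → ℝ) (μ : Fin D → ℝ) =>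
      ∑ j, μ j ^ a / (∏ i ∈ Finset.univ.erase j, (μ j - μ i)) * g 0 (μ j) :=
    IsJetOp.sum _ fun j => IsJetOp.term _ (contDiffOn_lagrangeCoeff a j) j 0
  obtain ⟨T, hT, hT'⟩ := hT0.exists_foldr_partialDeriv l
  have hinv : ∀ t, 0 ≤ t → T (invSeq t) μ
      = (-1) ^ (D - 1) * (t ^ a * ∏ i, ((l.count i)! / (μ i + t) ^ (l.count i + 1) : ℝ)) := by
    intro t ht
    have hg : ∀ r x, 0 < x → HasDerivAt (invSeq t r) (invSeq t (r + 1) x) x :=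
      fun r x hx => hasDerivAt_invSeq (by linarith) r
    obtain ⟨P, hP, hP'⟩ := exists_isPoly_sum_pow_div_add hD a t
    obtain ⟨Q, -, hQ0, hQ⟩ := foldr_partialDeriv_poly_add_prod hg hP ((-t) ^ a * (-1) ^ (D - 1)) l
    rw [← hT' _ hg μ hμ, foldr_partialDeriv_congr isOpen_distinctPos
      (G := fun μ => P μ + (-t) ^ a * (-1) ^ (D - 1) * ∏ i, invSeq t 0 (μ i)) _ l μ hμ, hQ μ hμ,
      hQ0 (by omega)]
    · have e : ∏ i, invSeq t (l.count i) (μ i)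
          = (-1) ^ (a + 2) * ∏ i, ((l.count i)! / (μ i + t) ^ (l.count i + 1) : ℝ) := by
        rw [← sum_count_ofFn m, ← Finset.prod_pow_eq_pow_sum, ← Finset.prod_mul_distrib]
        exact Finset.prod_congr rfl fun i _ => by rw [invSeq, mul_div_assoc]
      rw [e, neg_pow t a]
      have hs : ((-1 : ℝ) ^ a) * (-1) ^ (a + 2) = 1 := by rw [← pow_add]; exact Even.neg_one_pow ⟨a + 1, by ring⟩
      linear_combination (t ^ a * (-1) ^ (D - 1) *
        ∏ i, ((l.count i)! / (μ i + t) ^ (l.count i + 1) : ℝ)) * hs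
    · intro ν hν
      have := hP' ν hν.1 fun i => by linarith [hν.2 i]
      simpa [invSeq] using this
  -- The divided difference of `x^a` is a polynomial of degree at most `a`, killed by `a + 2`
  -- derivatives. Hence `log t` times the constant 1 can be subtracted from the divergent `log (x +
  -- t)` without changing `T`.
  have hone : T oneSeq μ = 0 := by
    obtain ⟨P, hP, hP'⟩ := exists_isPoly_sum_pow_div a (Finset.univ : Finset (Fin D))
    obtain ⟨Q, -, hQ0, hQ⟩ := foldr_partialDeriv_poly_add_prod
      (fun r x _ => hasDerivAt_oneSeq x r) hP 0 l
    rw [← hT' _ (fun r x _ => hasDerivAt_oneSeq x r) μ hμ, foldr_partialDeriv_congr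
      isOpen_distinctPos (G := fun μ => P μ + 0 * ∏ i, oneSeq 0 (μ i)) _ l μ hμ, hQ μ hμ,
      hQ0 (by omega)]
    · simp
    · intro ν hν
      simpa [oneSeq] using hP' ν hν.1
  have hlim : Tendsto (fun t => T (logSeq t) μ) atTop (𝓝 0) := by
    have h := hT.tendsto_zero (fun r x => tendsto_logSeq r x) μ
    refine h.congr fun t => ?_
    rw [hT.map_sub_const_mul, hone, mul_zero, sub_zero]
  have hderiv : ∀ t ∈ Set.Ici (0 : ℝ), HasDerivAt (fun t => T (logSeq t) μ) (T (invSeq t) μ) t := by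
    intro t ht
    refine hT.hasDerivAt_param (g' := invSeq) fun r i => ?_
    have hpos : 0 < t + μ i := add_pos_of_nonneg_of_pos ht (hμ.2 i)
    have h := hasDerivAt_logSeq hpos r
    rw [logSeq_comm] at h
    exact h.congr_of_eventuallyEq (Eventually.of_forall fun s => logSeq_comm s r (μ i))
  have hint : ∫ t in Set.Ioi (0 : ℝ), T (invSeq t) μ
      = (-1) ^ (D - 1) * resolventIntegral a (fun i => l.count i) μ := by
    rw [resolventIntegral, ← integral_const_mul]
    exact setIntegral_congr_fun measurableSet_Ioi fun t ht => hinv t (le_of_lt ht)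
  have hnn : ∀ t ∈ Set.Ioi (0 : ℝ),
      0 ≤ t ^ a * ∏ i, ((l.count i)! / (μ i + t) ^ (l.count i + 1) : ℝ) := by
    intro t ht
    have h0 : ∀ i, 0 < μ i + t := fun i => add_pos (hμ.2 i) ht
    exact mul_nonneg (pow_nonneg (le_of_lt ht) _)
      (Finset.prod_nonneg fun i _ => div_nonneg (by positivity) (pow_nonneg (h0 i).le _))
  -- The integrand has constant sign `(-1)^(D - 1)`, so the improper form needs no separate proof of
  -- integrability.
  have hftc : ∫ t in Set.Ioi (0 : ℝ), T (invSeq t) μ = 0 - T (logSeq 0) μ := by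
    rcases Nat.even_or_odd (D - 1) with h | h
    · refine integral_Ioi_of_hasDerivAt_of_nonneg' hderiv (fun t ht => ?_) hlim
      rw [hinv t (le_of_lt ht), h.neg_one_pow, one_mul]
      exact hnn t ht
    · refine integral_Ioi_of_hasDerivAt_of_nonpos' hderiv (fun t ht => ?_) hlim
      rw [hinv t (le_of_lt ht), h.neg_one_pow, neg_one_mul]
      exact neg_nonpos.2 (hnn t ht)
  have hfin : mixedPartial m (Lam (a + 2)) μ = T (logSeq 0) μ := by
    rw [← hT' _ (fun r x hx => hasDerivAt_logSeq (by linarith) r) μ hμ]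
    have : Lam (D := D) (a + 2) = fun μ =>
        ∑ j, μ j ^ a / (∏ i ∈ Finset.univ.erase j, (μ j - μ i)) * logSeq 0 0 (μ j) := by
      funext ν
      rw [Lam]
      refine Finset.sum_congr rfl fun j _ => ?_
      rw [show ((a + 2 : ℕ) : ℤ) - 2 = (a : ℤ) by push_cast; ring, zpow_natCast, logSeq, add_zero]
      ring
    rw [this, mixedPartial]
  obtain ⟨d, rfl⟩ : ∃ d, D = d + 1 := ⟨D - 1, by omega⟩
  rw [hfin, pow_succ]
  rw [add_tsub_cancel_right] at hint
  linarith

lemma continuousAt_resolventIntegral (hD : 0 < D) (a : ℕ) {n : Fin D → ℕ} (hn : ∑ i, n i = a + 2)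
    {μ : Fin D → ℝ} (hμ : ∀ i, 0 < μ i) : ContinuousAt (resolventIntegral a n) μ := by
  obtain ⟨δ, hδ, hδμ⟩ : ∃ δ : ℝ, 0 < δ ∧ ∀ i, δ < μ i := by
    have : NeZero D := ⟨hD.ne'⟩
    obtain ⟨j, hj⟩ := Finite.exists_min μ
    exact ⟨μ j / 2, half_pos (hμ j), fun i => by linarith [hj i, hμ j]⟩
  have hU : {ν : Fin D → ℝ | ∀ i, δ < ν i} ∈ 𝓝 μ := by
    refine IsOpen.mem_nhds ?_ hδμ
    simp only [Set.ofPred_forall]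
    exact isOpen_iInter_of_finite fun i => isOpen_lt continuous_const (continuous_apply i)
  -- Near `μ` all coordinates exceed `δ`, and `(t + δ)^a` over `(t + δ)^(∑ (n_i + 1)) = (t + δ)^(a +
  -- 2 + D)` leaves the exponent `-(D + 2)`.
  refine continuousAt_of_dominated
    (bound := fun t => (∏ i, ((n i)! : ℝ)) * ((t + δ) ^ (-(D + 2 : ℝ)))) ?_ ?_ ?_ ?_
  · refine Eventually.of_forall fun ν => Measurable.aestronglyMeasurable ?_
    fun_prop
  · filter_upwards [hU] with ν hν
    refine (ae_restrict_mem measurableSet_Ioi).mono fun t ht => ?_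
    have ht0 : 0 < t := ht
    have hnu : ∀ i, 0 < ν i + t := fun i => by linarith [hν i]
    rw [Real.norm_of_nonneg (mul_nonneg (by positivity) (Finset.prod_nonneg fun i _ =>
      div_nonneg (by positivity) (pow_nonneg (hnu i).le _)))]
    calc t ^ a * ∏ i, ((n i)! / (ν i + t) ^ (n i + 1) : ℝ)
        ≤ (t + δ) ^ a * ∏ i, ((n i)! / (t + δ) ^ (n i + 1) : ℝ) := by
          refine mul_le_mul (pow_le_pow_left₀ ht0.le (by linarith) _)
            (Finset.prod_le_prod (fun i _ => div_nonneg (by positivity) (pow_nonneg (hnu i).le _))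
              fun i _ => ?_) (Finset.prod_nonneg fun i _ =>
                div_nonneg (by positivity) (pow_nonneg (hnu i).le _)) (by positivity)
          exact div_le_div_of_nonneg_left (by positivity) (by positivity)
            (pow_le_pow_left₀ (by positivity) (by linarith [hν i]) _)
      _ = _ := by
          rw [Finset.prod_div_distrib, Finset.prod_pow_eq_pow_sum, Finset.sum_add_distrib, hn]
          rw [show -(D + 2 : ℝ) = -((D + 2 : ℕ) : ℝ) by push_cast; ring,
            Real.rpow_neg (by positivity), Real.rpow_natCast]
          simp only [Finset.sum_const, Finset.card_univ, Fintype.card_fin, smul_eq_mul, mul_one]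
          have : (t + δ) ≠ 0 := by positivity
          field_simp
          rw [← pow_add]
          congr 1
          ring
  · exact (integrableOn_add_rpow_Ioi_of_lt (by
      have : (0 : ℝ) < D := by exact_mod_cast hD
      linarith) (by linarith)).const_mul _
  · refine (ae_restrict_mem measurableSet_Ioi).mono fun t ht => ?_
    refine continuousAt_const.mul (tendsto_finsetProd _ fun i _ => ?_)
    have : 0 < μ i + t := add_pos (hμ i) ht
    exact ContinuousAt.div continuousAt_const (((continuous_apply i).continuousAt.add continuousAt_const).pow _) (by positivity)

end LamFormula

/-! ### Linear algebra -/

section LinearAlgebra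

variable {D : ℕ}

/-- The unitary matrix whose columns are the vectors of an orthonormal basis. -/
noncomputable def basisMatrix (s : OrthonormalBasis (Fin D) ℂ (EuclideanSpace ℂ (Fin D))) :
    Matrix (Fin D) (Fin D) ℂ :=
  Matrix.of fun a j => s j a

lemma conjTranspose_basisMatrix_mul (s : OrthonormalBasis (Fin D) ℂ (EuclideanSpace ℂ (Fin D))) :
    (basisMatrix s)ᴴ * basisMatrix s = 1 := by
  ext i j
  have h := orthonormal_iff_ite.1 s.orthonormal i j
  rw [PiLp.inner_apply] at h
  simp only [Matrix.mul_apply, Matrix.conjTranspose_apply, basisMatrix, Matrix.of_apply,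
    Matrix.one_apply]
  rw [← h]
  exact Finset.sum_congr rfl fun x _ => by simp [mul_comm]

lemma basisMatrix_mul_conjTranspose (s : OrthonormalBasis (Fin D) ℂ (EuclideanSpace ℂ (Fin D))) :
    basisMatrix s * (basisMatrix s)ᴴ = 1 :=
  mul_eq_one_comm.1 (conjTranspose_basisMatrix_mul s)

lemma eq_basisMatrix_mul_diagonal {ρ : Matrix (Fin D) (Fin D) ℂ}
    {s : OrthonormalBasis (Fin D) ℂ (EuclideanSpace ℂ (Fin D))} {lam : Fin D → ℝ}
    (h : ∀ j, Matrix.toEuclideanLin ρ (s j) = (lam j : ℂ) • s j) :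
    ρ = basisMatrix s * Matrix.diagonal (fun i => (lam i : ℂ)) * (basisMatrix s)ᴴ := by
  have h1 : ρ * basisMatrix s = basisMatrix s * Matrix.diagonal (fun i => (lam i : ℂ)) := by
    ext a j
    have h2 := congrArg (fun v : EuclideanSpace ℂ (Fin D) => v a) (h j)
    simp only [Matrix.toLpLin_apply, PiLp.smul_apply, smul_eq_mul] at h2
    rw [Matrix.mul_diagonal, Matrix.mul_apply]
    simp only [basisMatrix, Matrix.of_apply]
    rw [mul_comm (s j a), ← h2]
    rfl
  rw [← h1, Matrix.mul_assoc, basisMatrix_mul_conjTranspose, Matrix.mul_one]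

lemma conjTranspose_mul_self_mul_basisMatrix {ρ : Matrix (Fin D) (Fin D) ℂ}
    {s : OrthonormalBasis (Fin D) ℂ (EuclideanSpace ℂ (Fin D))} {lam : Fin D → ℝ}
    (h : ∀ j, Matrix.toEuclideanLin ρ (s j) = (lam j : ℂ) • s j) :
    (basisMatrix s)ᴴ * ρ * basisMatrix s = Matrix.diagonal (fun i => (lam i : ℂ)) := by
  conv_lhs => rw [eq_basisMatrix_mul_diagonal h]
  simp only [← Matrix.mul_assoc, conjTranspose_basisMatrix_mul, Matrix.one_mul]
  rw [Matrix.mul_assoc, conjTranspose_basisMatrix_mul, Matrix.mul_one]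

lemma eigenvalue_nonneg {ρ : Matrix (Fin D) (Fin D) ℂ} (hρ : ρ.PosSemidef)
    {s : OrthonormalBasis (Fin D) ℂ (EuclideanSpace ℂ (Fin D))} {lam : Fin D → ℝ}
    (h : ∀ j, Matrix.toEuclideanLin ρ (s j) = (lam j : ℂ) • s j) (j : Fin D) : 0 ≤ lam j := by
  have h1 := hρ.conjTranspose_mul_mul_same (basisMatrix s)
  rw [conjTranspose_mul_self_mul_basisMatrix h, Matrix.posSemidef_diagonal_iff] at h1
  exact_mod_cast h1 j

lemma eigenvalue_pos {ρ : Matrix (Fin D) (Fin D) ℂ} (hρ : ρ.PosDef)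
    {s : OrthonormalBasis (Fin D) ℂ (EuclideanSpace ℂ (Fin D))} {lam : Fin D → ℝ}
    (h : ∀ j, Matrix.toEuclideanLin ρ (s j) = (lam j : ℂ) • s j) (j : Fin D) : 0 < lam j := by
  refine lt_of_le_of_ne (eigenvalue_nonneg hρ.posSemidef h j) fun h0 => ?_
  have h1 : ρ.det = ∏ i, (lam i : ℂ) := by
    conv_lhs => rw [eq_basisMatrix_mul_diagonal h]
    rw [Matrix.det_mul, Matrix.det_mul, mul_right_comm, ← Matrix.det_mul,
      basisMatrix_mul_conjTranspose, Matrix.det_one, one_mul, Matrix.det_diagonal]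
  have h2 := hρ.det_pos
  rw [h1, Finset.prod_eq_zero (Finset.mem_univ j) (by rw [← h0]; simp)] at h2
  exact lt_irrefl _ h2

lemma sum_eigenvalue {ρ : Matrix (Fin D) (Fin D) ℂ} (hρ : IsDensityMatrix ρ)
    {s : OrthonormalBasis (Fin D) ℂ (EuclideanSpace ℂ (Fin D))} {lam : Fin D → ℝ}
    (h : ∀ j, Matrix.toEuclideanLin ρ (s j) = (lam j : ℂ) • s j) : ∑ i, lam i = 1 := by
  have h1 := hρ.2
  rw [eq_basisMatrix_mul_diagonal h, Matrix.trace_mul_comm, ← Matrix.mul_assoc,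
    conjTranspose_basisMatrix_mul, Matrix.one_mul, Matrix.trace_diagonal] at h1
  exact_mod_cast h1

lemma trace_mul_self_re {ρ : Matrix (Fin D) (Fin D) ℂ}
    {s : OrthonormalBasis (Fin D) ℂ (EuclideanSpace ℂ (Fin D))} {lam : Fin D → ℝ}
    (h : ∀ j, Matrix.toEuclideanLin ρ (s j) = (lam j : ℂ) • s j) :
    (ρ * ρ).trace.re = ∑ i, lam i ^ 2 := by
  have h1 : ρ * ρ = basisMatrix s * (Matrix.diagonal (fun i => (lam i : ℂ)) *
      Matrix.diagonal (fun i => (lam i : ℂ))) * (basisMatrix s)ᴴ := by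
    conv_lhs => rw [eq_basisMatrix_mul_diagonal h]
    simp only [Matrix.mul_assoc]
    rw [← Matrix.mul_assoc (basisMatrix s)ᴴ, conjTranspose_basisMatrix_mul, Matrix.one_mul]
  rw [h1, Matrix.trace_mul_comm, ← Matrix.mul_assoc, conjTranspose_basisMatrix_mul, Matrix.one_mul,
    Matrix.diagonal_mul_diagonal, Matrix.trace_diagonal, Complex.re_sum]
  exact Finset.sum_congr rfl fun i _ => by rw [← Complex.ofReal_mul, Complex.ofReal_re, sq]

lemma sqrt_eq_of_eigenbasis {ρ : Matrix (Fin D) (Fin D) ℂ} (hρ : ρ.PosSemidef)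
    {s : OrthonormalBasis (Fin D) ℂ (EuclideanSpace ℂ (Fin D))} {lam : Fin D → ℝ}
    (h : ∀ j, Matrix.toEuclideanLin ρ (s j) = (lam j : ℂ) • s j) :
    CFC.sqrt ρ = basisMatrix s * Matrix.diagonal (fun i => ((√(lam i) : ℝ) : ℂ)) *
      (basisMatrix s)ᴴ := by
  refine CFC.sqrt_unique ?_ ?_
  · conv_rhs => rw [eq_basisMatrix_mul_diagonal h]
    simp only [Matrix.mul_assoc]
    rw [← Matrix.mul_assoc (basisMatrix s)ᴴ, conjTranspose_basisMatrix_mul, Matrix.one_mul,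
      ← Matrix.mul_assoc (Matrix.diagonal _) (Matrix.diagonal _), Matrix.diagonal_mul_diagonal]
    congr 3
    funext i
    rw [← Complex.ofReal_mul, Real.mul_self_sqrt (eigenvalue_nonneg hρ h i)]
  · rw [Matrix.nonneg_iff_posSemidef]
    refine Matrix.PosSemidef.mul_mul_conjTranspose_same ?_ _
    rw [Matrix.posSemidef_diagonal_iff]
    intro i
    exact_mod_cast Real.sqrt_nonneg _

lemma exists_eigenbasis {ρ : Matrix (Fin D) (Fin D) ℂ} (hρ : ρ.IsHermitian) :
    ∃ (s : OrthonormalBasis (Fin D) ℂ (EuclideanSpace ℂ (Fin D))) (lam : Fin D → ℝ),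
      ∀ j, Matrix.toEuclideanLin ρ (s j) = (lam j : ℂ) • s j := by
  refine ⟨hρ.eigenvectorBasis, hρ.eigenvalues, fun j => ?_⟩
  have := hρ.mulVec_eigenvectorBasis j
  ext a
  rw [Matrix.toLpLin_apply, this]
  simp

lemma tensorPow_mul (A B : Matrix (Fin D) (Fin D) ℂ) (k : ℕ) :
    tensorPow A k * tensorPow B k = tensorPow (A * B) k := by
  ext a b
  simp only [tensorPow, Matrix.mul_apply, Matrix.of_apply, ← Finset.prod_mul_distrib]
  rw [Finset.prod_univ_sum, Fintype.piFinset_univ]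

lemma tensorPow_one (k : ℕ) : tensorPow (1 : Matrix (Fin D) (Fin D) ℂ) k = 1 := by
  ext a b
  simp only [tensorPow, Matrix.of_apply, Matrix.one_apply, funext_iff, Finset.prod_ite_zero,
    Finset.prod_const_one, Finset.mem_univ, true_imp_iff]

lemma conjTranspose_tensorPow (A : Matrix (Fin D) (Fin D) ℂ) (k : ℕ) :
    (tensorPow A k)ᴴ = tensorPow Aᴴ k := by
  ext a b
  simp [tensorPow, Matrix.conjTranspose_apply]

lemma tensorPow_basisMatrix_mul_conjTranspose
    (s : OrthonormalBasis (Fin D) ℂ (EuclideanSpace ℂ (Fin D))) (k : ℕ) :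
    tensorPow (basisMatrix s) k * (tensorPow (basisMatrix s) k)ᴴ = 1 := by
  rw [conjTranspose_tensorPow, tensorPow_mul, basisMatrix_mul_conjTranspose, tensorPow_one]

lemma matrixElement_eq {k : ℕ} (s : OrthonormalBasis (Fin D) ℂ (EuclideanSpace ℂ (Fin D)))
    (M : Matrix (Fin k → Fin D) (Fin k → Fin D) ℂ) (m m' : Fin k → Fin D) :
    matrixElement s M m m' =
      ((tensorPow (basisMatrix s) k)ᴴ * M * tensorPow (basisMatrix s) k) m m' := by
  rw [Matrix.mul_assoc, Matrix.mul_apply, matrixElement, dotProduct]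
  refine Finset.sum_congr rfl fun a _ => ?_
  rw [Matrix.mul_apply, Matrix.mulVec, dotProduct]
  rfl

lemma swapOp_mul_tensorPow (A : Matrix (Fin D) (Fin D) ℂ) :
    swapOp D * tensorPow A 2 = tensorPow A 2 * swapOp D := by
  have hs : ∀ a b : Fin 2 → Fin D, a = b ∘ Equiv.swap 0 1 ↔ b = a ∘ Equiv.swap 0 1 := by
    intro a b
    constructor <;> rintro rfl <;> funext i <;> simp
  ext a b
  simp only [Matrix.mul_apply, swapOp, Matrix.of_apply, ite_mul, one_mul, zero_mul, mul_ite,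
    mul_one, mul_zero, tensorPow]
  simp_rw [hs a]
  simp [mul_comm]

lemma swapOp_mul_self : swapOp D * swapOp D = 1 := by
  ext a b
  have hs : ∀ a b : Fin 2 → Fin D, a = b ∘ Equiv.swap 0 1 ↔ b = a ∘ Equiv.swap 0 1 := by
    intro a b
    constructor <;> rintro rfl <;> funext i <;> simp
  simp only [Matrix.mul_apply, swapOp, Matrix.of_apply, ite_mul, one_mul, zero_mul,
    Matrix.one_apply]
  simp_rw [hs a]
  rw [Finset.sum_ite_eq' Finset.univ, if_pos (Finset.mem_univ _)]
  congr 1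
  simp only [eq_iff_iff]
  constructor
  · intro h
    have := congrArg (fun f => f ∘ Equiv.swap 0 1) h
    funext i
    simpa using congrFun this i
  · rintro rfl; rfl

lemma conjTranspose_swapOp : (swapOp D)ᴴ = swapOp D := by
  have hs : ∀ a b : Fin 2 → Fin D, a = b ∘ Equiv.swap 0 1 ↔ b = a ∘ Equiv.swap 0 1 := by
    intro a b
    constructor <;> rintro rfl <;> funext i <;> simp
  ext a b
  simp only [swapOp, Matrix.conjTranspose_apply, Matrix.of_apply, hs b a]
  split_ifs <;> simp

lemma traceNorm_eq {n : Type*} [Fintype n] [DecidableEq n] {A B : Matrix n n ℂ}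
    (hB : B.PosSemidef) (h : B * B = Aᴴ * A) : traceNorm A = B.trace.re := by
  rw [traceNorm, CFC.sqrt_unique h (Matrix.nonneg_iff_posSemidef.2 hB)]

/-- The trace norm of a matrix which is `diag(c) (1 + S)` in a product basis. -/
lemma traceNorm_of_matrixElement (s : OrthonormalBasis (Fin D) ℂ (EuclideanSpace ℂ (Fin D)))
    {A : Matrix (Fin 2 → Fin D) (Fin 2 → Fin D) ℂ} {c : (Fin 2 → Fin D) → ℝ}
    (hc : ∀ m, c (m ∘ Equiv.swap 0 1) = c m)
    (hA : (tensorPow (basisMatrix s) 2)ᴴ * A * tensorPow (basisMatrix s) 2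
      = Matrix.diagonal (fun m => (c m : ℂ)) * (1 + swapOp D)) :
    traceNorm A = ∑ m, |c m| * (1 + if m = m ∘ Equiv.swap 0 1 then 1 else 0) := by
  set V := tensorPow (basisMatrix s) 2 with hV
  have hVV : V * Vᴴ = 1 := tensorPow_basisMatrix_mul_conjTranspose s 2
  have hVV' : Vᴴ * V = 1 := mul_eq_one_comm.1 hVV
  have hcomm : ∀ c : (Fin 2 → Fin D) → ℝ, (∀ m, c (m ∘ Equiv.swap 0 1) = c m) →
      (1 + swapOp D) * Matrix.diagonal (fun m => (c m : ℂ))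
        = Matrix.diagonal (fun m => (c m : ℂ)) * (1 + swapOp D) := by
    intro c hc
    rw [Matrix.add_mul, Matrix.mul_add, Matrix.one_mul, Matrix.mul_one]
    congr 1
    ext a b
    rw [Matrix.mul_diagonal, Matrix.diagonal_mul, swapOp, Matrix.of_apply]
    split_ifs with h
    · rw [h, hc, mul_comm]
    · simp
  have hsq : (1 + swapOp D) * (1 + swapOp D) = (2 : ℂ) • (1 + swapOp D) := by
    rw [Matrix.add_mul, Matrix.mul_add, Matrix.mul_add, swapOp_mul_self, two_smul]
    simp only [Matrix.one_mul, Matrix.mul_one]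
    abel
  have hself : (1 + swapOp D)ᴴ = 1 + swapOp D := by
    rw [Matrix.conjTranspose_add, conjTranspose_swapOp, Matrix.conjTranspose_one]
  -- This is the absolute value of `A` in the product basis. Swap-symmetric diagonals commute with
  -- `1 + S`, and `(1 + S)² = 2 (1 + S)`, so `B0 = (1 + S) diag(|c| / 2) (1 + S)` is positive, with
  -- the same square as `diag(c) (1 + S)`.
  set B0 := Matrix.diagonal (fun m => ((|c m| : ℝ) : ℂ)) * (1 + swapOp D) with hB0
  have hcabs : ∀ m, |c (m ∘ Equiv.swap 0 1)| = |c m| := fun m => by rw [hc]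
  have hB0pos : B0.PosSemidef := by
    have h1 : (Matrix.diagonal (fun m => ((|c m| / 2 : ℝ) : ℂ))).PosSemidef := by
      rw [Matrix.posSemidef_diagonal_iff]
      intro i
      have : (0 : ℝ) ≤ |c i| / 2 := by positivity
      exact_mod_cast this
    have h2 := h1.conjTranspose_mul_mul_same (1 + swapOp D)
    rw [hself, hcomm _ fun m => by rw [hc], Matrix.mul_assoc, hsq, Matrix.mul_smul] at h2
    convert! h2 using 1
    rw [← Matrix.smul_mul, hB0, ← Matrix.diagonal_smul]
    congr 2
    funext m
    simp
    ring
  have hMM : B0 * B0 = (Vᴴ * A * V)ᴴ * (Vᴴ * A * V) := by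
    rw [hA, Matrix.conjTranspose_mul, hself, Matrix.diagonal_conjTranspose, hB0]
    have e : star (fun m => (c m : ℂ)) = fun m => (c m : ℂ) := by
      funext m; simp
    rw [e, hcomm c hc]
    have e2 : ∀ c : (Fin 2 → Fin D) → ℝ, (∀ m, c (m ∘ Equiv.swap 0 1) = c m) →
        Matrix.diagonal (fun m => (c m : ℂ)) * (1 + swapOp D) *
        (Matrix.diagonal (fun m => (c m : ℂ)) * (1 + swapOp D)) =
        Matrix.diagonal (fun m => ((c m * c m : ℝ) : ℂ)) * ((1 + swapOp D) * (1 + swapOp D)) := by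
      intro c hc
      rw [Matrix.mul_assoc, ← Matrix.mul_assoc (1 + swapOp D), hcomm c hc, Matrix.mul_assoc,
        ← Matrix.mul_assoc, Matrix.diagonal_mul_diagonal]
      simp
    rw [e2 c hc, e2 (fun m => |c m|) hcabs]
    simp
  have key : traceNorm A = (V * B0 * Vᴴ).trace.re := by
    refine traceNorm_eq (hB0pos.mul_mul_conjTranspose_same V) ?_
    calc V * B0 * Vᴴ * (V * B0 * Vᴴ) = V * B0 * (Vᴴ * V) * B0 * Vᴴ := by
          simp only [Matrix.mul_assoc]
      _ = V * (B0 * B0) * Vᴴ := by rw [hVV', Matrix.mul_one, Matrix.mul_assoc V]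
      _ = V * Vᴴ * Aᴴ * (V * Vᴴ) * A * (V * Vᴴ) := by
          rw [hMM]
          simp only [Matrix.conjTranspose_mul, Matrix.conjTranspose_conjTranspose, Matrix.mul_assoc]
      _ = Aᴴ * A := by rw [hVV, Matrix.one_mul, Matrix.mul_one, Matrix.mul_one]
  rw [key, Matrix.trace_mul_comm, ← Matrix.mul_assoc, hVV', Matrix.one_mul, Matrix.trace,
    Complex.re_sum]
  refine Finset.sum_congr rfl fun m _ => ?_
  rw [Matrix.diag_apply, hB0, Matrix.diagonal_mul, Complex.re_ofReal_mul, Matrix.add_apply,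
    Matrix.one_apply_eq, swapOp, Matrix.of_apply]
  split_ifs <;> simp

end LinearAlgebra

/-! ### The Gaussian ensemble -/

section Gaussian

variable {D : ℕ}

/-- The squared Euclidean norm. -/
noncomputable def sqNorm (z : Fin D → ℂ) : ℝ := ∑ i, ‖z i‖ ^ 2

@[fun_prop]
lemma measurable_sqNorm : Measurable (sqNorm (D := D)) := by
  unfold sqNorm
  fun_prop

lemma sqNorm_nonneg (z : Fin D → ℂ) : 0 ≤ sqNorm z := by
  unfold sqNorm
  positivity

lemma sqNorm_eq_zero {z : Fin D → ℂ} : sqNorm z = 0 ↔ z = 0 := by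
  rw [sqNorm, Finset.sum_eq_zero_iff_of_nonneg fun i _ => by positivity]
  simp [funext_iff]

lemma sqNorm_smul (c : ℝ) (z : Fin D → ℂ) : sqNorm ((c : ℂ) • z) = c ^ 2 * sqNorm z := by
  simp [sqNorm, mul_pow, Finset.mul_sum]

lemma sqNorm_eq_dotProduct (z : Fin D → ℂ) : (sqNorm z : ℂ) = star z ⬝ᵥ z := by
  simp [sqNorm, dotProduct, Complex.conj_mul']

lemma sqNorm_mulVec {U : Matrix (Fin D) (Fin D) ℂ} (hU : Uᴴ * U = 1) (z : Fin D → ℂ) :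
    sqNorm (U *ᵥ z) = sqNorm z := by
  have : (sqNorm (U *ᵥ z) : ℂ) = sqNorm z := by
    rw [sqNorm_eq_dotProduct, sqNorm_eq_dotProduct, Matrix.star_mulVec, ← Matrix.dotProduct_mulVec,
      Matrix.mulVec_mulVec, hU, Matrix.one_mulVec]
  exact_mod_cast this

lemma normalize_eq (z : Fin D → ℂ) : normalize z = (((√(sqNorm z))⁻¹ : ℝ) : ℂ) • z := rfl

@[fun_prop]
lemma measurable_normalize : Measurable (normalize (D := D)) := by
  refine measurable_pi_lambda _ fun i => ?_
  simp only [normalize_eq, Pi.smul_apply, smul_eq_mul]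
  fun_prop

lemma measurable_mulVec (A : Matrix (Fin D) (Fin D) ℂ) : Measurable fun z => A *ᵥ z := by
  refine measurable_pi_lambda _ fun i => ?_
  simp only [Matrix.mulVec, dotProduct]
  fun_prop

lemma normalize_smul {c : ℝ} (hc : 0 < c) (z : Fin D → ℂ) :
    normalize ((c : ℂ) • z) = normalize z := by
  rw [normalize_eq, normalize_eq, sqNorm_smul, Real.sqrt_mul (sq_nonneg c), Real.sqrt_sq hc.le,
    smul_smul, ← Complex.ofReal_mul, mul_inv, mul_right_comm, inv_mul_cancel₀ hc.ne', one_mul]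

lemma normalize_mulVec {U : Matrix (Fin D) (Fin D) ℂ} (hU : Uᴴ * U = 1) (z : Fin D → ℂ) :
    normalize (U *ᵥ z) = U *ᵥ normalize z := by
  rw [normalize_eq, normalize_eq, sqNorm_mulVec hU, Matrix.mulVec_smul]

lemma normalize_mulVec_normalize (A : Matrix (Fin D) (Fin D) ℂ) (z : Fin D → ℂ) :
    normalize (A *ᵥ normalize z) = normalize (A *ᵥ z) := by
  rcases eq_or_ne z 0 with rfl | hz
  · rw [normalize_eq 0]; simp
  · have : 0 < (√(sqNorm z))⁻¹ := by
      have : 0 < sqNorm z := (sqNorm_nonneg z).lt_of_ne' (mt sqNorm_eq_zero.1 hz)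
      positivity
    rw [normalize_eq z, Matrix.mulVec_smul, normalize_smul this]

lemma measurePreserving_mulVec_volume {U : Matrix (Fin D) (Fin D) ℂ} (hU : Uᴴ * U = 1) :
    MeasurePreserving (fun z => U *ᵥ z) (volume : Measure (Fin D → ℂ)) volume := by
  refine ⟨measurable_mulVec U, ?_⟩
  have hdet : LinearMap.det ((Matrix.toLin' U).restrictScalars ℝ) = 1 := by
    rw [LinearMap.det_restrictScalars, LinearMap.det_toLin', Algebra.norm_complex_apply]
    have h := congrArg Matrix.det hU
    rw [Matrix.det_mul, Matrix.det_conjTranspose, Matrix.det_one] at h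
    have h2 : ((Complex.normSq U.det : ℝ) : ℂ) = 1 := by
      rw [Complex.normSq_eq_conj_mul_self]; exact h
    exact_mod_cast h2
  have h := Measure.map_linearMap_addHaar_eq_smul_addHaar (volume : Measure (Fin D → ℂ))
    (f := (Matrix.toLin' U).restrictScalars ℝ) (by rw [hdet]; exact one_ne_zero)
  rw [hdet] at h
  simp only [inv_one, abs_one, ENNReal.ofReal_one, one_smul] at h
  exact h

/-- The Gaussian density. -/
noncomputable def gaussDensity (z : Fin D → ℂ) : ℝ :=
  ((D : ℝ) / Real.pi) ^ D * Real.exp (-(D * sqNorm z))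

@[fun_prop]
lemma measurable_gaussDensity : Measurable (gaussDensity (D := D)) := by
  unfold gaussDensity
  fun_prop

lemma gaussDensity_nonneg (z : Fin D → ℂ) : 0 ≤ gaussDensity z := by
  unfold gaussDensity
  positivity

lemma gaussianEnsemble_eq :
    gaussianEnsemble D = volume.withDensity fun z => ENNReal.ofReal (gaussDensity z) := by
  rw [gaussianEnsemble]
  congr 1
  funext z
  rw [Finset.prod_mul_distrib, ← Real.exp_sum, gaussDensity]
  simp [sqNorm, Finset.mul_sum, div_pow]

lemma lintegral_gaussianEnsemble {f : (Fin D → ℂ) → ENNReal} (hf : Measurable f) :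
    ∫⁻ z, f z ∂gaussianEnsemble D = ∫⁻ z, ENNReal.ofReal (gaussDensity z) * f z := by
  rw [gaussianEnsemble_eq, lintegral_withDensity_eq_lintegral_mul _ (by fun_prop) hf]
  rfl

lemma measurePreserving_mulVec {U : Matrix (Fin D) (Fin D) ℂ} (hU : Uᴴ * U = 1) :
    MeasurePreserving (fun z => U *ᵥ z) (gaussianEnsemble D) (gaussianEnsemble D) := by
  refine ⟨measurable_mulVec U, ?_⟩
  refine Measure.ext_of_lintegral _ fun f hf => ?_
  have hfU : Measurable fun z => f (U *ᵥ z) := hf.comp (measurable_mulVec U)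
  rw [lintegral_map hf (measurable_mulVec U), lintegral_gaussianEnsemble hf,
    lintegral_gaussianEnsemble hfU,
    ← (measurePreserving_mulVec_volume hU).lintegral_comp (f := fun z =>
      ENNReal.ofReal (gaussDensity z) * f z) (by fun_prop)]
  simp only [gaussDensity, sqNorm_mulVec hU]

/-- The Scrooge ensemble of the diagonal matrix with entries `lam`. -/
noncomputable def diagScrooge (lam : Fin D → ℝ) : Measure (Fin D → ℂ) :=
  ((gaussianEnsemble D).withDensity fun z =>
    ENNReal.ofReal (D * (∑ i, lam i * ‖z i‖ ^ 2) / sqNorm z)).map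
      fun z => normalize fun i => ((√(lam i) : ℝ) : ℂ) * z i

lemma measurable_normalize_sqrt (lam : Fin D → ℝ) :
    Measurable fun z : Fin D → ℂ => normalize fun i => ((√(lam i) : ℝ) : ℂ) * z i := by
  refine measurable_normalize.comp (measurable_pi_lambda _ fun i => ?_)
  fun_prop

lemma lintegral_diagScrooge (lam : Fin D → ℝ) {f : (Fin D → ℂ) → ENNReal} (hf : Measurable f) :
    ∫⁻ z, f z ∂diagScrooge lam = ∫⁻ z, ENNReal.ofReal (D * (∑ i, lam i * ‖z i‖ ^ 2) / sqNorm z) *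
      f (normalize fun i => ((√(lam i) : ℝ) : ℂ) * z i) ∂gaussianEnsemble D := by
  have hf' : Measurable fun z : Fin D → ℂ => f (normalize fun i => ((√(lam i) : ℝ) : ℂ) * z i) :=
    hf.comp (measurable_normalize_sqrt lam)
  rw [diagScrooge, lintegral_map hf (measurable_normalize_sqrt lam),
    lintegral_withDensity_eq_lintegral_mul _ (by fun_prop) hf']
  rfl

lemma dotProduct_normalize_re (A : Matrix (Fin D) (Fin D) ℂ) (z : Fin D → ℂ) :
    (star (normalize z) ⬝ᵥ (A *ᵥ normalize z)).re = (star z ⬝ᵥ (A *ᵥ z)).re / sqNorm z := by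
  rw [normalize_eq, Matrix.mulVec_smul, star_smul, smul_dotProduct, dotProduct_smul, smul_smul,
    smul_eq_mul, Complex.star_def, Complex.conj_ofReal, ← Complex.ofReal_mul, Complex.re_ofReal_mul,
    ← mul_inv, Real.mul_self_sqrt (sqNorm_nonneg z)]
  ring

lemma dotProduct_eigen_re {ρ : Matrix (Fin D) (Fin D) ℂ}
    {s : OrthonormalBasis (Fin D) ℂ (EuclideanSpace ℂ (Fin D))} {lam : Fin D → ℝ}
    (h : ∀ j, Matrix.toEuclideanLin ρ (s j) = (lam j : ℂ) • s j) (z : Fin D → ℂ) :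
    (star (basisMatrix s *ᵥ z) ⬝ᵥ (ρ *ᵥ (basisMatrix s *ᵥ z))).re = ∑ i, lam i * ‖z i‖ ^ 2 := by
  rw [Matrix.star_mulVec, ← Matrix.dotProduct_mulVec, Matrix.mulVec_mulVec, Matrix.mulVec_mulVec,
    conjTranspose_mul_self_mul_basisMatrix h, dotProduct, Complex.re_sum]
  refine Finset.sum_congr rfl fun i _ => ?_
  rw [Matrix.mulVec_diagonal, Pi.star_apply, mul_left_comm, Complex.star_def, Complex.conj_mul',
    Complex.re_ofReal_mul, ← Complex.ofReal_pow, Complex.ofReal_re]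

/-- Substitute the rotated Gaussian vector. The inner normalisation drops out of the map, which
ignores positive scale, and survives only as the factor `1 / ‖z‖²` in the weight. -/
lemma scrooge_eq_map_diagScrooge {ρ : Matrix (Fin D) (Fin D) ℂ} (hρ : ρ.PosSemidef)
    {s : OrthonormalBasis (Fin D) ℂ (EuclideanSpace ℂ (Fin D))} {lam : Fin D → ℝ}
    (h : ∀ j, Matrix.toEuclideanLin ρ (s j) = (lam j : ℂ) • s j) :
    scrooge ρ = (diagScrooge lam).map fun z => basisMatrix s *ᵥ z := by
  have hU := conjTranspose_basisMatrix_mul s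
  refine Measure.ext_of_lintegral _ fun f hf => ?_
  have hm1 : Measurable fun z => normalize (CFC.sqrt ρ *ᵥ z) :=
    measurable_normalize.comp (measurable_mulVec _)
  have hm2 : Measurable fun z : Fin D → ℂ =>
      ENNReal.ofReal ((D : ℝ) * (star z ⬝ᵥ (ρ *ᵥ z)).re) := by
    have h1 := measurable_mulVec ρ
    have h2 : Measurable fun z : Fin D → ℂ => star z ⬝ᵥ (ρ *ᵥ z) := by
      simp only [dotProduct]
      refine Finset.measurable_sum _ fun i _ => ?_
      exact ((Complex.continuous_conj.measurable).comp (measurable_pi_apply i)).mul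
        ((measurable_pi_apply i).comp h1)
    exact ((Complex.measurable_re.comp h2).const_mul _).ennreal_ofReal
  have hf1 : Measurable fun z => f (normalize (CFC.sqrt ρ *ᵥ z)) := hf.comp hm1
  have hf2 : Measurable fun z => f (basisMatrix s *ᵥ z) := hf.comp (measurable_mulVec _)
  have hf3 := hm2.mul hf1
  have hf4 : Measurable fun z : Fin D → ℂ =>
      ((fun z : Fin D → ℂ => ENNReal.ofReal ((D : ℝ) * (star z ⬝ᵥ (ρ *ᵥ z)).re)) *
        fun z => f (normalize (CFC.sqrt ρ *ᵥ z))) (normalize z) := hf3.comp measurable_normalize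
  rw [scrooge, lintegral_map hf hm1, lintegral_withDensity_eq_lintegral_mul _ hm2 hf1,
    haarEnsemble, lintegral_map hf3 measurable_normalize,
    ← (measurePreserving_mulVec hU).lintegral_comp hf4,
    lintegral_map hf (measurable_mulVec _), lintegral_diagScrooge _ hf2]
  refine lintegral_congr fun z => ?_
  simp only [Pi.mul_apply]
  rw [dotProduct_normalize_re, dotProduct_eigen_re h, sqNorm_mulVec hU, normalize_mulVec_normalize,
    sqrt_eq_of_eigenbasis hρ h, Matrix.mulVec_mulVec, Matrix.mul_assoc, hU, Matrix.mul_one,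
    ← Matrix.mulVec_mulVec, normalize_mulVec hU, mul_div_assoc]
  congr 5
  funext i
  rw [Matrix.mulVec_diagonal]

lemma norm_normalize_apply_le (z : Fin D → ℂ) (i : Fin D) : ‖normalize z i‖ ≤ 1 := by
  rw [normalize_eq, Pi.smul_apply, smul_eq_mul, norm_mul, Complex.norm_real, norm_inv,
    Real.norm_of_nonneg (Real.sqrt_nonneg _)]
  have h : ‖z i‖ ≤ √(sqNorm z) := by
    refine Real.le_sqrt_of_sq_le ?_
    exact Finset.single_le_sum (f := fun i => ‖z i‖ ^ 2) (fun i _ => by positivity)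
      (Finset.mem_univ i)
  exact inv_mul_le_one_of_le₀ h (Real.sqrt_nonneg _)

lemma ae_diagScrooge_norm_le (lam : Fin D → ℝ) :
    ∀ᵐ z ∂diagScrooge lam, ∀ i, ‖z i‖ ≤ 1 := by
  rw [diagScrooge, ae_map_iff (measurable_normalize_sqrt lam).aemeasurable]
  · exact Eventually.of_forall fun z i => norm_normalize_apply_le _ i
  · simp only [Set.ofPred_forall]
    exact MeasurableSet.iInter fun i =>
      measurableSet_le (measurable_pi_apply i).norm measurable_const

lemma integrable_prod_diagScrooge {lam : Fin D → ℝ} [IsFiniteMeasure (diagScrooge lam)] {k : ℕ}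
    (a b : Fin k → Fin D) :
    Integrable (fun z => ∏ i, (z (a i) * star (z (b i)))) (diagScrooge lam) := by
  refine Integrable.of_bound (C := 1) (Continuous.aestronglyMeasurable (by fun_prop)) ?_
  filter_upwards [ae_diagScrooge_norm_le lam] with z hz
  rw [norm_prod]
  refine Finset.prod_le_one (fun i _ => norm_nonneg _) fun i _ => ?_
  rw [norm_mul, norm_star]
  exact mul_le_one₀ (hz _) (norm_nonneg _) (hz _)

lemma kthMoment_map_mulVec {lam : Fin D → ℝ} [IsFiniteMeasure (diagScrooge lam)]
    (U : Matrix (Fin D) (Fin D) ℂ) (k : ℕ) :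
    kthMoment ((diagScrooge lam).map fun z => U *ᵥ z) k
      = tensorPow U k * kthMoment (diagScrooge lam) k * (tensorPow U k)ᴴ := by
  ext a b
  have hexp : ∀ (z : Fin D → ℂ) (a : Fin k → Fin D),
      ∏ i, (U *ᵥ z) (a i) = ∑ c, tensorPow U k a c * ∏ i, z (c i) := by
    intro z a
    simp only [Matrix.mulVec, dotProduct]
    rw [Finset.prod_univ_sum, Fintype.piFinset_univ]
    simp only [Finset.prod_mul_distrib, tensorPow, Matrix.of_apply]
  rw [kthMoment, Matrix.of_apply, integral_map (measurable_mulVec U).aemeasurable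
    (Continuous.aestronglyMeasurable (by fun_prop))]
  have h1 : ∀ z : Fin D → ℂ, ∏ i, ((U *ᵥ z) (a i) * star ((U *ᵥ z) (b i)))
      = ∑ d, ∑ c, tensorPow U k a c * star (tensorPow U k b d) *
        ∏ i, (z (c i) * star (z (d i))) := by
    intro z
    rw [Finset.prod_mul_distrib, ← star_prod, hexp, hexp, star_sum, Finset.sum_mul_sum,
      Finset.sum_comm]
    refine Finset.sum_congr rfl fun d _ => Finset.sum_congr rfl fun c _ => ?_
    rw [Finset.prod_mul_distrib, ← star_prod, star_mul']
    ring
  simp_rw [h1]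
  rw [integral_finsetSum _ fun d _ => integrable_finsetSum _ fun c _ =>
    (integrable_prod_diagScrooge c d).const_mul _, Matrix.mul_apply]
  refine Finset.sum_congr rfl fun d _ => ?_
  rw [integral_finsetSum _ fun c _ => (integrable_prod_diagScrooge c d).const_mul _,
    Matrix.mul_apply, Finset.sum_mul]
  refine Finset.sum_congr rfl fun c _ => ?_
  rw [integral_const_mul, Matrix.conjTranspose_apply, mul_right_comm]
  rfl

lemma conjTranspose_mul_kthMoment_scrooge_mul {ρ : Matrix (Fin D) (Fin D) ℂ} (hρ : ρ.PosSemidef)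
    {s : OrthonormalBasis (Fin D) ℂ (EuclideanSpace ℂ (Fin D))} {lam : Fin D → ℝ}
    (h : ∀ j, Matrix.toEuclideanLin ρ (s j) = (lam j : ℂ) • s j)
    [IsFiniteMeasure (diagScrooge lam)] (k : ℕ) :
    (tensorPow (basisMatrix s) k)ᴴ * kthMoment (scrooge ρ) k * tensorPow (basisMatrix s) k
      = kthMoment (diagScrooge lam) k := by
  have h1 := tensorPow_basisMatrix_mul_conjTranspose s k
  have h2 := mul_eq_one_comm.1 h1
  rw [scrooge_eq_map_diagScrooge hρ h, kthMoment_map_mulVec]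
  simp only [← Matrix.mul_assoc, h2, Matrix.one_mul]
  rw [Matrix.mul_assoc, h2, Matrix.mul_one]

lemma diagScrooge_map_phase (lam : Fin D → ℝ) {w : Fin D → ℂ} (hw : ∀ i, ‖w i‖ = 1) :
    (diagScrooge lam).map (fun z => Matrix.diagonal w *ᵥ z) = diagScrooge lam := by
  have hU : (Matrix.diagonal w)ᴴ * Matrix.diagonal w = 1 := by
    rw [Matrix.diagonal_conjTranspose, Matrix.diagonal_mul_diagonal, ← Matrix.diagonal_one]
    congr 1
    funext i
    simp [Complex.conj_mul', hw]
  refine Measure.ext_of_lintegral _ fun f hf => ?_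
  have hm : Measurable fun z : Fin D → ℂ =>
      ENNReal.ofReal (D * (∑ i, lam i * ‖z i‖ ^ 2) / sqNorm z) *
      f (normalize fun i => ((√(lam i) : ℝ) : ℂ) * z i) :=
    Measurable.mul (by fun_prop) (hf.comp (measurable_normalize_sqrt lam))
  have hf' : Measurable fun z => f (Matrix.diagonal w *ᵥ z) := hf.comp (measurable_mulVec _)
  rw [lintegral_map hf (measurable_mulVec _), lintegral_diagScrooge _ hf,
    lintegral_diagScrooge _ hf',
    ← (measurePreserving_mulVec hU).lintegral_comp hm]
  refine lintegral_congr fun z => ?_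
  rw [sqNorm_mulVec hU]
  simp only [← normalize_mulVec hU, Matrix.mulVec_diagonal, norm_mul, hw,
    one_mul]
  congr 3
  funext i
  rw [Matrix.mulVec_diagonal]
  ring

lemma kthMoment_diagScrooge_perm (lam : Fin D → ℝ) {k : ℕ} (m : Fin k → Fin D)
    (σ : Equiv.Perm (Fin k)) :
    kthMoment (diagScrooge lam) k m (m ∘ σ) = kthMoment (diagScrooge lam) k m m := by
  simp only [kthMoment, Matrix.of_apply, Finset.prod_mul_distrib, Function.comp_apply]
  congr 1
  funext z
  rw [Equiv.prod_comp σ fun i => star (z (m i))]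

/-- If all values have equal multiplicities, bijections between fibres glue to a permutation. If `j`
occurs `n` and `n' ≠ n` times, rotating coordinate `j` by the angle `π / (n - n')` preserves the
ensemble and multiplies the moment by `-1`. -/
lemma exists_perm_of_kthMoment_ne_zero {lam : Fin D → ℝ} {k : ℕ} {m m' : Fin k → Fin D}
    (h : kthMoment (diagScrooge lam) k m m' ≠ 0) : ∃ σ : Equiv.Perm (Fin k), m' = m ∘ σ := by
  by_cases hc : ∀ j, Fintype.card {i // m' i = j} = Fintype.card {i // m i = j}
  · refine ⟨Equiv.ofFiberEquiv fun j => Fintype.equivOfCardEq (hc j), ?_⟩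
    funext i
    exact (Equiv.ofFiberEquiv_map _ i).symm
  · exfalso
    push Not at hc
    obtain ⟨j, hj⟩ := hc
    set n := Fintype.card {i // m i = j} with hn
    set n' := Fintype.card {i // m' i = j} with hn'
    set θ : ℝ := Real.pi / (n - n') with hθ
    set w : Fin D → ℂ := fun i => if i = j then Complex.exp (θ * Complex.I) else 1 with hw
    have hw1 : ∀ i, ‖w i‖ = 1 := by
      intro i
      simp only [hw]
      split_ifs
      · exact Complex.norm_exp_ofReal_mul_I θ
      · simp
    have hcount : ∀ (f : Fin k → Fin D), ∏ i, w (f i)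
        = Complex.exp (θ * Complex.I) ^ Fintype.card {i // f i = j} := by
      intro f
      simp only [hw]
      rw [Finset.prod_ite, Finset.prod_const_one, mul_one, Finset.prod_const,
        Fintype.card_subtype]
    have hphase : (∏ i, w (m i)) * star (∏ i, w (m' i)) = -1 := by
      rw [hcount, hcount, star_pow, Complex.star_def, ← Complex.exp_conj, ← Complex.exp_nat_mul,
        ← Complex.exp_nat_mul, ← Complex.exp_add, ← Complex.exp_pi_mul_I]
      congr 1
      have h0 : (n : ℂ) - n' ≠ 0 := sub_ne_zero.2 (by exact_mod_cast hj.symm)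
      rw [map_mul, Complex.conj_ofReal, Complex.conj_I, ← hn, ← hn', hθ]
      push_cast
      field_simp
      ring
    have key : kthMoment (diagScrooge lam) k m m' = -kthMoment (diagScrooge lam) k m m' := by
      conv_lhs => rw [← diagScrooge_map_phase lam hw1]
      rw [kthMoment, Matrix.of_apply, integral_map (measurable_mulVec _).aemeasurable
        (Continuous.aestronglyMeasurable (by fun_prop)), kthMoment, Matrix.of_apply,
        ← neg_one_mul, ← hphase, ← integral_const_mul]
      congr 1
      funext z
      simp only [Matrix.mulVec_diagonal, Finset.prod_mul_distrib, star_mul', star_prod]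
      ring
    exact h (self_eq_neg.1 key)

end Gaussian

/-! ### Gaussian integrals -/

section GaussianIntegrals

variable {D : ℕ}

lemma lintegral_comp_ofReal_smul {f : (Fin D → ℂ) → ENNReal} (hf : Measurable f) {r : ℝ}
    (hr : 0 < r) :
    ∫⁻ z, f ((r : ℂ) • z) = ENNReal.ofReal (((r ^ 2) ^ D)⁻¹) * ∫⁻ z, f z := by
  have h := Measure.map_addHaar_smul (volume : Measure (Fin D → ℂ)) hr.ne'
  have hfin : Module.finrank ℝ (Fin D → ℂ) = 2 * D := by
    rw [Module.finrank_pi_fintype]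
    simp [Complex.finrank_real_complex, mul_comm]
  rw [hfin, pow_mul, abs_of_pos (by positivity)] at h
  have h2 := lintegral_map (μ := (volume : Measure (Fin D → ℂ))) hf (measurable_const_smul r)
  rw [h, lintegral_smul_measure, smul_eq_mul] at h2
  rw [h2]
  refine lintegral_congr fun z => ?_
  congr 1

/-- Rescale `z` by `√(c / D)`: the volume contributes `(D / c)^D` and the homogeneity of `h` one
more factor `D / c`. -/
lemma lintegral_mul_exp_eq (hD : 0 < D) {h : (Fin D → ℂ) → ℝ} (hm : Measurable h)
    (hh : ∀ (c : ℝ) (z : Fin D → ℂ), 0 < c → h ((c : ℂ) • z) = c ^ 2 * h z) {c : ℝ} (hc : 0 < c) :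
    ∫⁻ z, ENNReal.ofReal (h z * Real.exp (-(c * sqNorm z)))
      = ENNReal.ofReal ((D / c : ℝ) ^ (D + 1)) *
        ∫⁻ z, ENNReal.ofReal (h z * Real.exp (-(D * sqNorm z))) := by
  have hD' : (0 : ℝ) < D := by exact_mod_cast hD
  have hr : 0 < √(c / D) := Real.sqrt_pos.2 (by positivity)
  have h1 := lintegral_comp_ofReal_smul
    (f := fun z => ENNReal.ofReal (h z * Real.exp (-(D * sqNorm z)))) (by fun_prop) hr
  have h2 : ∀ z : Fin D → ℂ, ENNReal.ofReal (h z * Real.exp (-(c * sqNorm z)))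
      = ENNReal.ofReal (D / c) * ENNReal.ofReal (h (((√(c / D) : ℝ) : ℂ) • z) *
        Real.exp (-(D * sqNorm (((√(c / D) : ℝ) : ℂ) • z)))) := by
    intro z
    rw [← ENNReal.ofReal_mul (by positivity), hh _ _ hr, sqNorm_smul,
      Real.sq_sqrt (by positivity)]
    congr 1
    field_simp
  simp_rw [h2]
  rw [lintegral_const_mul _ (by
    have : Measurable fun z : Fin D → ℂ => ((√(c / D) : ℝ) : ℂ) • z := by fun_prop
    fun_prop), h1, ← mul_assoc, ← ENNReal.ofReal_mul (by positivity),
    Real.sq_sqrt (by positivity)]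
  congr 2
  rw [← inv_pow, inv_div, pow_succ, mul_comm]

lemma lintegral_Ioi_exp {c N : ℝ} (hN : 0 < N) :
    ∫⁻ x in Set.Ioi c, ENNReal.ofReal (Real.exp (-(x * N)))
      = ENNReal.ofReal (Real.exp (-(c * N)) / N) := by
  have h1 : ∀ x, -(x * N) = -N * x := fun x => by ring
  simp_rw [h1]
  rw [← ofReal_integral_eq_lintegral_ofReal (integrableOn_exp_mul_Ioi (by linarith) c)
    (Eventually.of_forall fun x => (Real.exp_pos _).le), integral_exp_mul_Ioi (by linarith)]
  congr 1
  rw [neg_div_neg_eq]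

lemma lintegral_Ioi_div_pow (hD : 0 < D) :
    ∫⁻ c in Set.Ioi (D : ℝ), ENNReal.ofReal ((D / c : ℝ) ^ (D + 1)) = 1 := by
  have hD' : (0 : ℝ) < D := by exact_mod_cast hD
  have h1 : ∀ c ∈ Set.Ioi (D : ℝ), ENNReal.ofReal ((D / c : ℝ) ^ (D + 1))
      = ENNReal.ofReal (D ^ (D + 1) * c ^ (-(D + 1 : ℝ))) := by
    intro c hc
    have hc0 : 0 < c := hD'.trans hc
    rw [div_pow, Real.rpow_neg hc0.le, div_eq_mul_inv]
    congr 3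
    exact_mod_cast (Real.rpow_natCast c (D + 1)).symm
  rw [setLIntegral_congr_fun measurableSet_Ioi h1,
    ← ofReal_integral_eq_lintegral_ofReal
      ((integrableOn_Ioi_rpow_of_lt (by linarith) hD').const_mul _), integral_const_mul,
    integral_Ioi_rpow_of_lt (by linarith) hD', ← ENNReal.ofReal_one]
  · congr 1
    rw [show -(D + 1 : ℝ) + 1 = -(D : ℝ) by ring, Real.rpow_neg hD'.le, Real.rpow_natCast]
    field_simp
    ring
  · refine (ae_restrict_mem measurableSet_Ioi).mono fun c hc => ?_
    have hc0 : 0 < c := hD'.trans hc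
    positivity

/-- The norm of a Gaussian vector is independent of its direction, with `E ‖z‖² = 1`: for a
function `h` homogeneous of degree two, `E [h / ‖z‖²] = E h`. -/
lemma lintegral_div_sqNorm (hD : 0 < D) {h : (Fin D → ℂ) → ℝ} (hm : Measurable h)
    (h0 : ∀ z, 0 ≤ h z)
    (hh : ∀ (c : ℝ) (z : Fin D → ℂ), 0 < c → h ((c : ℂ) • z) = c ^ 2 * h z) :
    ∫⁻ z, ENNReal.ofReal (h z / sqNorm z) ∂gaussianEnsemble D
      = ∫⁻ z, ENNReal.ofReal (h z) ∂gaussianEnsemble D := by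
  have hD' : (0 : ℝ) < D := by exact_mod_cast hD
  set κ : ℝ := ((D : ℝ) / Real.pi) ^ D with hκ
  have hκ0 : 0 ≤ κ := by positivity
  rw [lintegral_gaussianEnsemble (by fun_prop), lintegral_gaussianEnsemble (by fun_prop)]
  have hR : ∀ z : Fin D → ℂ, ENNReal.ofReal (gaussDensity z) * ENNReal.ofReal (h z)
      = ENNReal.ofReal κ * ENNReal.ofReal (h z * Real.exp (-(D * sqNorm z))) := by
    intro z
    rw [← ENNReal.ofReal_mul (gaussDensity_nonneg z), ← ENNReal.ofReal_mul hκ0, gaussDensity]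
    congr 1
    ring
  -- Here `exp (-D N) / N` with `N = ‖z‖²` is the integral of `exp (-c N)` over `c > D`. After
  -- exchanging integrals, scaling leaves `∫ (D / c)^(D + 1) dc = 1`.
  have hL : ∀ z : Fin D → ℂ, ENNReal.ofReal (gaussDensity z) * ENNReal.ofReal (h z / sqNorm z)
      = ENNReal.ofReal κ * ∫⁻ c in Set.Ioi (D : ℝ),
          ENNReal.ofReal (h z * Real.exp (-(c * sqNorm z))) := by
    intro z
    simp_rw [ENNReal.ofReal_mul (h0 z)]
    rw [lintegral_const_mul _ (by fun_prop)]
    rcases eq_or_ne z 0 with rfl | hz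
    · have : h 0 = 0 := by
        have := hh 2 0 (by norm_num)
        rw [smul_zero] at this
        linarith
      simp [this]
    · have hN : 0 < sqNorm z := (sqNorm_nonneg z).lt_of_ne' (mt sqNorm_eq_zero.1 hz)
      rw [lintegral_Ioi_exp hN, ← ENNReal.ofReal_mul (h0 z), ← ENNReal.ofReal_mul hκ0,
        ← ENNReal.ofReal_mul (gaussDensity_nonneg z), gaussDensity]
      congr 1
      ring
  simp_rw [hR, hL]
  have hmeas : Measurable fun p : (Fin D → ℂ) × ℝ =>
      ENNReal.ofReal (h p.1 * Real.exp (-(p.2 * sqNorm p.1))) := by fun_prop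
  have hmeas' : Measurable fun z : Fin D → ℂ => ∫⁻ c in Set.Ioi (D : ℝ),
      ENNReal.ofReal (h z * Real.exp (-(c * sqNorm z))) := hmeas.lintegral_prod_right'
  rw [lintegral_const_mul _ hmeas', lintegral_const_mul _ (by fun_prop),
    lintegral_lintegral_swap hmeas.aemeasurable]
  congr 1
  rw [setLIntegral_congr_fun measurableSet_Ioi fun c hc =>
    lintegral_mul_exp_eq hD hm hh (hD'.trans hc), lintegral_mul_const _ (by fun_prop),
    lintegral_Ioi_div_pow hD, one_mul]

lemma integral_norm_pow_mul_exp {b : ℝ} (hb : 0 < b) (n : ℕ) :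
    ∫ z : ℂ, ‖z‖ ^ (2 * n) * Real.exp (-(b * ‖z‖ ^ 2)) = Real.pi * n ! / b ^ (n + 1) := by
  have h := Complex.integral_rpow_mul_exp_neg_mul_rpow (p := 2) (q := (2 * n : ℕ)) (b := b)
    (by norm_num) (by have : (0 : ℝ) ≤ (2 * n : ℕ) := Nat.cast_nonneg _
                      linarith) hb
  simp only [Real.rpow_natCast, Real.rpow_ofNat, neg_mul] at h
  rw [h]
  have h1 : ((2 * n : ℕ) + 2 : ℝ) / 2 = (n : ℝ) + 1 := by push_cast; ring
  have h2 : -((2 * n : ℕ) + 2 : ℝ) / 2 = -((n + 1 : ℕ) : ℝ) := by push_cast; ring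
  rw [h1, h2, Real.Gamma_nat_eq_factorial, Real.rpow_neg hb.le, Real.rpow_natCast]
  ring

lemma lintegral_prod_norm_pow_mul_exp {b : Fin D → ℝ} (hb : ∀ i, 0 < b i) (n : Fin D → ℕ) :
    ∫⁻ z : Fin D → ℂ, ENNReal.ofReal (∏ i, (‖z i‖ ^ (2 * n i) * Real.exp (-(b i * ‖z i‖ ^ 2))))
      = ENNReal.ofReal (∏ i, (Real.pi * (n i)! / b i ^ (n i + 1))) := by
  have h : ∫ z : Fin D → ℂ, ∏ i, (‖z i‖ ^ (2 * n i) * Real.exp (-(b i * ‖z i‖ ^ 2)))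
      = ∏ i, (Real.pi * (n i)! / b i ^ (n i + 1)) := by
    rw [integral_fintype_prod_volume_eq_prod
      fun i (z : ℂ) => ‖z‖ ^ (2 * n i) * Real.exp (-(b i * ‖z‖ ^ 2))]
    exact Finset.prod_congr rfl fun i _ => integral_norm_pow_mul_exp (hb i) (n i)
  rw [← h, ofReal_integral_eq_lintegral_ofReal]
  -- The Bochner integral of a non-integrable function is 0 by convention, so a nonzero value proves
  -- integrability.
  · refine Integrable.of_integral_ne_zero ?_
    rw [h]
    refine Finset.prod_ne_zero_iff.2 fun i _ => ?_
    have := hb i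
    positivity
  · exact Eventually.of_forall fun z => by positivity

end GaussianIntegrals

/-! ### The moments of the Scrooge ensemble in the eigenbasis -/

section DiagonalMoments

variable {D : ℕ}

lemma prod_comp_eq_prod_pow_count {R : Type*} [CommMonoid R] {k : ℕ} (m : Fin k → Fin D)
    (f : Fin D → R) : ∏ i, f (m i) = ∏ j, f j ^ (List.ofFn m).count j := by
  have h : ∀ l : List (Fin D), (l.map f).prod = ∏ j, f j ^ l.count j := by
    intro l
    induction l with
    | nil => simp
    | cons i l ih =>
      simp only [List.map_cons, List.prod_cons, ih, List.count_cons, pow_add,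
        Finset.prod_mul_distrib, beq_iff_eq]
      rw [mul_comm]
      congr 1
      simp [pow_ite]
  rw [← h, List.map_ofFn, List.prod_ofFn]
  rfl

lemma sqNorm_sqrt_mul {lam : Fin D → ℝ} (hl : ∀ i, 0 ≤ lam i) (z : Fin D → ℂ) :
    sqNorm (fun i => ((√(lam i) : ℝ) : ℂ) * z i) = ∑ i, lam i * ‖z i‖ ^ 2 := by
  simp only [sqNorm, norm_mul, mul_pow, Complex.norm_real]
  refine Finset.sum_congr rfl fun i _ => ?_
  rw [Real.norm_of_nonneg (Real.sqrt_nonneg _), Real.sq_sqrt (hl i)]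

lemma norm_normalize_sqrt_sq {lam : Fin D → ℝ} (hl : ∀ i, 0 ≤ lam i) (z : Fin D → ℂ)
    (j : Fin D) :
    ‖normalize (fun i => ((√(lam i) : ℝ) : ℂ) * z i) j‖ ^ 2
      = lam j * ‖z j‖ ^ 2 / ∑ i, lam i * ‖z i‖ ^ 2 := by
  have h0 : 0 ≤ ∑ i, lam i * ‖z i‖ ^ 2 := Finset.sum_nonneg fun i _ => mul_nonneg (hl i) (by positivity)
  rw [normalize_eq, sqNorm_sqrt_mul hl, Pi.smul_apply, smul_eq_mul, norm_mul, norm_mul,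
    Complex.norm_real, Complex.norm_real, mul_pow, mul_pow, Real.norm_eq_abs, Real.norm_eq_abs,
    sq_abs, sq_abs, Real.sq_sqrt (hl j), inv_pow, Real.sq_sqrt h0]
  ring

lemma pos_of_sum_eq_one {lam : Fin D → ℝ} (h : ∑ i, lam i = 1) : 0 < D := by
  rcases Nat.eq_zero_or_pos D with rfl | h'
  · simp at h
  · exact h'

/-- Once `‖z‖²` is removed, the mass is the Gaussian mean of `D ∑ λ_i |z_i|²`, and each `|z_i|²` has
mean `1 / D`. -/
lemma diagScrooge_univ {lam : Fin D → ℝ} (hl : ∀ i, 0 ≤ lam i) (hs : ∑ i, lam i = 1) :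
    diagScrooge lam Set.univ = 1 := by
  have hD := pos_of_sum_eq_one hs
  have hD' : (0 : ℝ) < D := by exact_mod_cast hD
  rw [← lintegral_one, lintegral_diagScrooge _ measurable_const]
  simp only [mul_one]
  have h0 : ∀ z : Fin D → ℂ, 0 ≤ D * (∑ i, lam i * ‖z i‖ ^ 2) := fun z =>
    mul_nonneg hD'.le (Finset.sum_nonneg fun i _ => mul_nonneg (hl i) (by positivity))
  rw [lintegral_div_sqNorm hD (by fun_prop) h0, lintegral_gaussianEnsemble (by fun_prop)]
  · have h1 : ∀ z : Fin D → ℂ,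
        ENNReal.ofReal (gaussDensity z) * ENNReal.ofReal (D * (∑ i, lam i * ‖z i‖ ^ 2))
        = ∑ i, ENNReal.ofReal (lam i * (D * ((D : ℝ) / Real.pi) ^ D)) *
          ENNReal.ofReal (∏ j, (‖z j‖ ^ (2 * if i = j then 1 else 0) *
            Real.exp (-(D * ‖z j‖ ^ 2)))) := by
      intro z
      rw [← ENNReal.ofReal_mul (gaussDensity_nonneg z), Finset.mul_sum, Finset.mul_sum,
        ENNReal.ofReal_sum_of_nonneg fun i _ => mul_nonneg (gaussDensity_nonneg z)
          (mul_nonneg hD'.le (mul_nonneg (hl i) (by positivity)))]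
      refine Finset.sum_congr rfl fun i _ => ?_
      rw [← ENNReal.ofReal_mul (mul_nonneg (hl i) (by positivity)), Finset.prod_mul_distrib,
        ← Real.exp_sum, gaussDensity, sqNorm]
      congr 1
      rw [Finset.prod_eq_single i (fun j _ hj => by rw [if_neg hj.symm]; simp) (by simp), if_pos rfl,
        Finset.sum_neg_distrib, ← Finset.mul_sum]
      ring
    simp_rw [h1]
    rw [lintegral_finsetSum _ fun i _ => by fun_prop]
    have h2 : ∀ i, ∫⁻ z : Fin D → ℂ, ENNReal.ofReal (lam i * (D * ((D : ℝ) / Real.pi) ^ D)) *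
        ENNReal.ofReal (∏ j, (‖z j‖ ^ (2 * if i = j then 1 else 0) *
            Real.exp (-(D * ‖z j‖ ^ 2)))) = ENNReal.ofReal (lam i) := by
      intro i
      rw [lintegral_const_mul _ (by fun_prop), lintegral_prod_norm_pow_mul_exp fun _ => hD',
        ← ENNReal.ofReal_mul (mul_nonneg (hl i) (by positivity))]
      congr 1
      rw [Finset.prod_div_distrib, Finset.prod_mul_distrib, Finset.prod_pow_eq_pow_sum,
        Finset.sum_add_distrib]
      have : ∏ j, ((((if i = j then 1 else 0 : ℕ))! : ℕ) : ℝ) = 1 :=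
        Finset.prod_eq_one fun j _ => by split_ifs <;> simp
      rw [this]
      simp only [Finset.prod_const, Finset.sum_const, Finset.card_univ, Fintype.card_fin,
        smul_eq_mul, mul_one, Finset.sum_ite_eq, Finset.mem_univ, if_true]
      rw [div_pow, add_comm, pow_succ]
      have := Real.pi_pos
      field_simp
    simp_rw [h2]
    rw [← ENNReal.ofReal_sum_of_nonneg fun i _ => hl i, hs, ENNReal.ofReal_one]
  · intro c z hc
    simp only [Pi.smul_apply, smul_eq_mul, norm_mul, Complex.norm_real, mul_pow, Real.norm_eq_abs,
      sq_abs, Finset.mul_sum]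
    exact Finset.sum_congr rfl fun i _ => by ring

lemma lintegral_prod_norm_sq_diagScrooge {lam : Fin D → ℝ} (hl : ∀ i, 0 ≤ lam i)
    (hD : 0 < D) {a : ℕ} (m : Fin (a + 2) → Fin D) :
    ∫⁻ z, ENNReal.ofReal (∏ i, ‖z (m i)‖ ^ 2) ∂diagScrooge lam
      = ∫⁻ t in Set.Ioi (0 : ℝ), ENNReal.ofReal (t ^ a / a ! *
        ∏ j, (lam j ^ (List.ofFn m).count j * ((List.ofFn m).count j)! /
          (1 + lam j * t) ^ ((List.ofFn m).count j + 1))) := by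
  have hD' : (0 : ℝ) < D := by exact_mod_cast hD
  set n : Fin D → ℕ := fun j => (List.ofFn m).count j with hn
  set S : (Fin D → ℂ) → ℝ := fun z => ∑ i, lam i * ‖z i‖ ^ 2 with hS
  have hSm : Measurable S := by fun_prop
  have hS0 : ∀ z, 0 ≤ S z := fun z => Finset.sum_nonneg fun i _ => mul_nonneg (hl i) (by positivity)
  set Q : (Fin D → ℂ) → ℝ := fun z => ∏ i, (lam (m i) * ‖z (m i)‖ ^ 2) with hQ
  have hQm : Measurable Q := by fun_prop
  have hQ0 : ∀ z, 0 ≤ Q z := fun z =>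
    Finset.prod_nonneg fun i _ => mul_nonneg (hl _) (by positivity)
  have hQn : ∀ z, Q z = (∏ j, lam j ^ n j) * ∏ j, ‖z j‖ ^ (2 * n j) := by
    intro z
    rw [hQ, ← Finset.prod_mul_distrib]
    simp only
    rw [prod_comp_eq_prod_pow_count m fun j => lam j * ‖z j‖ ^ 2]
    refine Finset.prod_congr rfl fun j _ => ?_
    rw [mul_pow, ← pow_mul]
  -- The Gamma integral for `1 / S^(a + 1)` fails at `S z = 0`; there both sides vanish because `Q
  -- z` does.
  have hQz : ∀ z, S z = 0 → Q z = 0 := by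
    intro z hz
    have := (Finset.sum_eq_zero_iff_of_nonneg fun i _ => mul_nonneg (hl i) (by positivity)).1 hz
    exact Finset.prod_eq_zero (Finset.mem_univ 0) (this _ (Finset.mem_univ _))
  rw [lintegral_diagScrooge _ (by fun_prop)]
  have e1 : ∀ z : Fin D → ℂ, ENNReal.ofReal (D * (∑ i, lam i * ‖z i‖ ^ 2) / sqNorm z) *
      ENNReal.ofReal (∏ i, ‖normalize (fun i => ((√(lam i) : ℝ) : ℂ) * z i) (m i)‖ ^ 2)
      = ENNReal.ofReal (D * (S z * Q z / S z ^ (a + 2)) / sqNorm z) := by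
    intro z
    rw [← ENNReal.ofReal_mul (div_nonneg (mul_nonneg hD'.le (hS0 z)) (sqNorm_nonneg z))]
    simp_rw [norm_normalize_sqrt_sq hl]
    rw [Finset.prod_div_distrib, Finset.prod_const, Finset.card_univ, Fintype.card_fin]
    congr 1
    simp only [hS, hQ]
    ring
  simp_rw [e1]
  have hnonneg : ∀ z, 0 ≤ D * (S z * Q z / S z ^ (a + 2)) := fun z =>
    mul_nonneg hD'.le (div_nonneg (mul_nonneg (hS0 z) (hQ0 z)) (pow_nonneg (hS0 z) _))
  rw [lintegral_div_sqNorm hD (by fun_prop) hnonneg, lintegral_gaussianEnsemble (by fun_prop)]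
  -- Of the power `D^(a + 2)`, one factor is the weight and the others come from `1 / S^(a + 1) =
  -- D^(a + 1) / a! ∫ t^a exp (-D S t) dt`.
  · have e2 : ∀ z : Fin D → ℂ, ENNReal.ofReal (gaussDensity z) *
        ENNReal.ofReal (D * (S z * Q z / S z ^ (a + 2)))
        = ∫⁻ t in Set.Ioi (0 : ℝ), ENNReal.ofReal (((D : ℝ) / Real.pi) ^ D * D ^ (a + 2) *
          (t ^ a / a !) * (∏ j, lam j ^ n j)) * ENNReal.ofReal (∏ j, (‖z j‖ ^ (2 * n j) *
            Real.exp (-((D * (1 + lam j * t)) * ‖z j‖ ^ 2)))) := by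
      intro z
      have hexp : ∀ t ∈ Set.Ioi (0 : ℝ),
          ENNReal.ofReal (((D : ℝ) / Real.pi) ^ D * D ^ (a + 2) *
          (t ^ a / a !) * (∏ j, lam j ^ n j)) * ENNReal.ofReal (∏ j, (‖z j‖ ^ (2 * n j) *
            Real.exp (-((D * (1 + lam j * t)) * ‖z j‖ ^ 2))))
          = ENNReal.ofReal ((gaussDensity z * D ^ (a + 2) / a ! * Q z) *
            (t ^ (a : ℝ) * Real.exp (-(D * S z * t)))) := by
        intro t ht
        have ht0 : 0 < t := ht
        rw [← ENNReal.ofReal_mul (mul_nonneg (by positivity)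
          (Finset.prod_nonneg fun j _ => pow_nonneg (hl j) _)), hQn, Finset.prod_mul_distrib,
          ← Real.exp_sum, Real.rpow_natCast, gaussDensity]
        have : ∑ j, -((D * (1 + lam j * t)) * ‖z j‖ ^ 2) = -(D * sqNorm z) + -(D * S z * t) := by
          rw [hS, sqNorm, Finset.mul_sum, Finset.mul_sum, Finset.sum_mul, ← Finset.sum_neg_distrib,
            ← Finset.sum_neg_distrib, ← Finset.sum_add_distrib]
          exact Finset.sum_congr rfl fun j _ => by ring
        rw [this, Real.exp_add]
        congr 1
        ring
      rw [setLIntegral_congr_fun measurableSet_Ioi hexp]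
      rcases (hS0 z).eq_or_lt with h | h
      · simp [hQz z h.symm]
      · have hDS : 0 < D * S z := mul_pos hD' h
        have hint : ∫ t in Set.Ioi (0 : ℝ), t ^ (a : ℝ) * Real.exp (-(D * S z * t))
            = a ! / (D * S z) ^ (a + 1) := by
          have := Real.integral_rpow_mul_exp_neg_mul_Ioi (a := (a : ℝ) + 1) (by positivity) hDS
          rw [add_sub_cancel_right, Real.Gamma_nat_eq_factorial] at this
          rw [this, one_div, Real.inv_rpow hDS.le, ← Nat.cast_add_one, Real.rpow_natCast]
          ring
        have hc : 0 ≤ gaussDensity z * D ^ (a + 2) / a ! * Q z :=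
          mul_nonneg (div_nonneg (mul_nonneg (gaussDensity_nonneg z) (by positivity))
            (by positivity)) (hQ0 z)
        simp_rw [ENNReal.ofReal_mul hc]
        rw [lintegral_const_mul _ (by fun_prop), ← ofReal_integral_eq_lintegral_ofReal, hint,
          ← ENNReal.ofReal_mul hc, ← ENNReal.ofReal_mul (gaussDensity_nonneg z)]
        · congr 1
          have : ((a ! : ℕ) : ℝ) ≠ 0 := by positivity
          field_simp
          ring
        · refine Integrable.of_integral_ne_zero ?_
          rw [hint]
          positivity
        · refine (ae_restrict_mem measurableSet_Ioi).mono fun t ht => ?_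
          have ht0 : 0 < t := ht
          positivity
    simp_rw [e2]
    rw [lintegral_lintegral_swap (Measurable.aemeasurable (by fun_prop))]
    refine setLIntegral_congr_fun measurableSet_Ioi fun t ht => ?_
    have ht0 : 0 < t := ht
    have hb : ∀ j, 0 < D * (1 + lam j * t) := fun j =>
      mul_pos hD' (by have := mul_nonneg (hl j) ht0.le; linarith)
    rw [lintegral_const_mul _ (by fun_prop), lintegral_prod_norm_pow_mul_exp hb,
      ← ENNReal.ofReal_mul (mul_nonneg (by positivity)
          (Finset.prod_nonneg fun j _ => pow_nonneg (hl j) _))]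
    change _ = ENNReal.ofReal (t ^ a / a ! * ∏ j, (lam j ^ n j * (n j)! /
      (1 + lam j * t) ^ (n j + 1)))
    congr 1
    simp only [mul_pow, Finset.prod_div_distrib, Finset.prod_mul_distrib,
      Finset.prod_pow_eq_pow_sum, Finset.sum_add_distrib]
    have hsum : ∑ j, n j = a + 2 := sum_count_ofFn m
    rw [hsum]
    simp only [Finset.prod_const, Finset.sum_const, Finset.card_univ, Fintype.card_fin,
        smul_eq_mul, mul_one]
    have h1 : ∏ j, (1 + lam j * t) ^ (n j + 1) ≠ 0 :=
      Finset.prod_ne_zero_iff.2 fun j _ => by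
        have := mul_nonneg (hl j) ht0.le
        positivity
    have h2 : ((a ! : ℕ) : ℝ) ≠ 0 := by positivity
    rw [div_pow, pow_add (D : ℝ) (a + 2) D]
    have := Real.pi_pos
    clear_value n
    simp only [mul_comm (lam _) t] at h1 ⊢
    field_simp
  · intro c z hc
    have hSc : S ((c : ℂ) • z) = c ^ 2 * S z := by
      simp only [hS, Pi.smul_apply, smul_eq_mul, norm_mul, Complex.norm_real, mul_pow,
        Real.norm_eq_abs, sq_abs, Finset.mul_sum]
      exact Finset.sum_congr rfl fun i _ => by ring
    have hQc : Q ((c : ℂ) • z) = (c ^ 2) ^ (a + 2) * Q z := by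
      have : ∀ i, lam (m i) * ‖((c : ℂ) • z) (m i)‖ ^ 2 = c ^ 2 * (lam (m i) * ‖z (m i)‖ ^ 2) := by
        intro i
        simp only [Pi.smul_apply, smul_eq_mul, norm_mul, Complex.norm_real, mul_pow,
          Real.norm_eq_abs, sq_abs]
        ring
      simp only [hQ, this]
      rw [Finset.prod_mul_distrib, Finset.prod_const, Finset.card_univ, Fintype.card_fin]
    rw [hSc, hQc, mul_pow]
    rcases (hS0 z).eq_or_lt with h | h
    · simp [← h]
    · field_simp

lemma sum_lintegral_prod_norm_sq_diagScrooge {lam : Fin D → ℝ} (hl : ∀ i, 0 ≤ lam i)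
    (hs : ∑ i, lam i = 1) (k : ℕ) :
    ∑ m : Fin k → Fin D, ∫⁻ z, ENNReal.ofReal (∏ i, ‖z (m i)‖ ^ 2) ∂diagScrooge lam = 1 := by
  rw [← lintegral_finsetSum _ fun m _ => by fun_prop, ← diagScrooge_univ hl hs, ← lintegral_one,
    lintegral_diagScrooge _ (by fun_prop), lintegral_diagScrooge _ measurable_const]
  refine lintegral_congr fun z => ?_
  rcases eq_or_ne (∑ i, lam i * ‖z i‖ ^ 2) 0 with h | h
  · simp [h]
  · congr 1
    rw [← ENNReal.ofReal_sum_of_nonneg fun m _ => Finset.prod_nonneg fun i _ => by positivity,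
      ← Fintype.piFinset_univ, ← Finset.prod_univ_sum (fun _ => Finset.univ)
        (fun _ j => ‖normalize (fun i => ((√(lam i) : ℝ) : ℂ) * z i) j‖ ^ 2)]
    simp_rw [norm_normalize_sqrt_sq hl]
    rw [← Finset.sum_div, div_self h]
    simp

lemma kthMoment_diagScrooge_self (lam : Fin D → ℝ) {k : ℕ} (m : Fin k → Fin D) :
    kthMoment (diagScrooge lam) k m m
      = ((∫⁻ z, ENNReal.ofReal (∏ i, ‖z (m i)‖ ^ 2) ∂diagScrooge lam).toReal : ℂ) := by
  rw [kthMoment, Matrix.of_apply, ← integral_eq_lintegral_of_nonneg_ae, ← integral_complex_ofReal]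
  · congr 1
    funext z
    push_cast
    exact Finset.prod_congr rfl fun i _ => by rw [Complex.star_def, Complex.mul_conj']
  · exact Eventually.of_forall fun z => Finset.prod_nonneg fun i _ => by positivity
  · exact Measurable.aestronglyMeasurable (by fun_prop)

lemma kthMoment_diagScrooge_of_pos {lam : Fin D → ℝ} (hl : ∀ i, 0 < lam i)
    (hD : 0 < D) {a : ℕ} (m : Fin (a + 2) → Fin D) :
    kthMoment (diagScrooge lam) (a + 2) m m
      = ((1 / (a ! : ℝ) * (∏ i, (lam i)⁻¹) *
        resolventIntegral a (fun i => (List.ofFn m).count i) fun i => (lam i)⁻¹ : ℝ) : ℂ) := by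
  rw [kthMoment_diagScrooge_self, lintegral_prod_norm_sq_diagScrooge (fun i => (hl i).le) hD,
    ← integral_eq_lintegral_of_nonneg_ae, resolventIntegral, ← integral_const_mul]
  · congr 1
    refine setIntegral_congr_fun measurableSet_Ioi fun t ht => ?_
    have ht0 : 0 < t := ht
    have : ∀ j, lam j ^ (List.ofFn m).count j * ((List.ofFn m).count j)! /
          (1 + lam j * t) ^ ((List.ofFn m).count j + 1)
        = (lam j)⁻¹ * (((List.ofFn m).count j)! /
          ((lam j)⁻¹ + t) ^ ((List.ofFn m).count j + 1)) := by
      intro j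
      have hj := hl j
      have : (lam j)⁻¹ + t = (1 + lam j * t) / lam j := by field_simp
      rw [this, div_pow, pow_succ (lam j)]
      field_simp
    simp only [this, Finset.prod_mul_distrib]
    ring
  · refine (ae_restrict_mem measurableSet_Ioi).mono fun t ht => ?_
    have ht0 : 0 < t := ht
    refine mul_nonneg (by positivity) (Finset.prod_nonneg fun j _ => ?_)
    have := hl j
    positivity
  · exact Measurable.aestronglyMeasurable (by fun_prop)

end DiagonalMoments

/-! ### The second moment -/

section SecondMoment

variable {D : ℕ}

lemma perm_fin_two (σ : Equiv.Perm (Fin 2)) : σ = 1 ∨ σ = Equiv.swap 0 1 := by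
  revert σ
  decide

lemma eq_comp_swap_iff (m : Fin 2 → Fin D) : m = m ∘ Equiv.swap 0 1 ↔ m 0 = m 1 := by
  constructor
  · intro h
    simpa using congrFun h 0
  · intro h
    funext i
    fin_cases i <;> simp [h]

/-- For tuples fixed by the swap, `1 + S` has diagonal entry 2, which the denominator compensates.
-/
lemma kthMoment_diagScrooge_two (lam : Fin D → ℝ) :
    kthMoment (diagScrooge lam) 2 = Matrix.diagonal (fun m : Fin 2 → Fin D =>
      (((∫⁻ z, ENNReal.ofReal (∏ i, ‖z (m i)‖ ^ 2) ∂diagScrooge lam).toReal /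
        (1 + if m = m ∘ Equiv.swap 0 1 then 1 else 0) : ℝ) : ℂ)) * (1 + swapOp D) := by
  ext m m'
  rw [Matrix.diagonal_mul, Matrix.add_apply, swapOp, Matrix.of_apply, Matrix.one_apply]
  by_cases h : m = m'
  · subst h
    rw [if_pos rfl, kthMoment_diagScrooge_self]
    split_ifs
    · push_cast
      ring
    · simp
  · rw [if_neg h]
    by_cases h2 : m = m' ∘ Equiv.swap 0 1
    · have h3 : m' = m ∘ Equiv.swap 0 1 := by
        rw [h2]
        funext i
        simp
      have h4 : ¬ m = m ∘ Equiv.swap 0 1 := fun h5 => h (h5.trans h3.symm)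
      rw [if_pos h2, if_neg h4, h3, kthMoment_diagScrooge_perm, kthMoment_diagScrooge_self]
      simp
    · rw [if_neg h2, add_zero, mul_zero]
      by_contra h0
      obtain ⟨σ, hσ⟩ := exists_perm_of_kthMoment_ne_zero h0
      rcases perm_fin_two σ with rfl | rfl
      · exact h (by rw [hσ]; rfl)
      · refine h2 ?_
        rw [hσ]
        funext i
        simp

lemma conjTranspose_mul_tensorPow_mul {ρ : Matrix (Fin D) (Fin D) ℂ}
    {s : OrthonormalBasis (Fin D) ℂ (EuclideanSpace ℂ (Fin D))} {lam : Fin D → ℝ}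
    (h : ∀ j, Matrix.toEuclideanLin ρ (s j) = (lam j : ℂ) • s j) :
    (tensorPow (basisMatrix s) 2)ᴴ * (tensorPow ρ 2 * (1 + swapOp D)) * tensorPow (basisMatrix s) 2
      = Matrix.diagonal (fun m : Fin 2 → Fin D => ((lam (m 0) * lam (m 1) : ℝ) : ℂ)) *
        (1 + swapOp D) := by
  have h1 : (1 + swapOp D) * tensorPow (basisMatrix s) 2
      = tensorPow (basisMatrix s) 2 * (1 + swapOp D) := by
    rw [Matrix.add_mul, Matrix.mul_add, swapOp_mul_tensorPow, Matrix.one_mul, Matrix.mul_one]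
  rw [Matrix.mul_assoc, Matrix.mul_assoc, h1, ← Matrix.mul_assoc, ← Matrix.mul_assoc,
    conjTranspose_tensorPow, tensorPow_mul, tensorPow_mul, conjTranspose_mul_self_mul_basisMatrix h]
  congr 1
  ext m m'
  rw [tensorPow, Matrix.of_apply, Fin.prod_univ_two, Matrix.diagonal_apply, Matrix.diagonal_apply,
    Matrix.diagonal_apply]
  by_cases hm : m = m'
  · subst hm
    simp
  · rw [if_neg hm]
    by_cases h0 : m 0 = m' 0
    · have h1 : m 1 ≠ m' 1 := fun h1 => hm (by
        funext i
        fin_cases i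
        · exact h0
        · exact h1)
      simp [h1]
    · simp [h0]

lemma prod_factorial_count (m : Fin 2 → Fin D) :
    ∏ j, (((List.ofFn m).count j)! : ℝ) = 1 + if m = m ∘ Equiv.swap 0 1 then 1 else 0 := by
  have hcount : ∀ j, (List.ofFn m).count j
      = (if m 0 = j then 1 else 0) + if m 1 = j then 1 else 0 := by
    intro j
    simp [List.ofFn_succ, List.count_cons, add_comm]
  simp only [hcount, eq_comp_swap_iff]
  by_cases h : m 0 = m 1
  · rw [if_pos h, Finset.prod_eq_single (m 0)]
    · simp [← h]
      norm_num
    · intro j _ hj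
      rw [if_neg hj.symm, if_neg (h ▸ hj.symm)]
      simp
    · simp
  · rw [if_neg h, add_zero]
    refine Finset.prod_eq_one fun j _ => ?_
    have : ¬ (m 0 = j ∧ m 1 = j) := fun ⟨h0, h1⟩ => h (h0.trans h1.symm)
    split_ifs <;> simp_all

/-- In the integral formula with `a = 0`, bound every `1 + λ_j t` by `exp (λ_j t)`. As `∑ λ_j = 1`,
the denominator is at most `exp (t (1 + λ_(m 0) + λ_(m 1)))`, which integrates exactly. -/
lemma le_lintegral_diagScrooge {lam : Fin D → ℝ} (hl : ∀ i, 0 ≤ lam i)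
    (hs : ∑ i, lam i = 1) (m : Fin 2 → Fin D) :
    ENNReal.ofReal (lam (m 0) * lam (m 1) * (1 + if m = m ∘ Equiv.swap 0 1 then 1 else 0) /
        (1 + lam (m 0) + lam (m 1)))
      ≤ ∫⁻ z, ENNReal.ofReal (∏ i, ‖z (m i)‖ ^ 2) ∂diagScrooge lam := by
  have hD := pos_of_sum_eq_one hs
  set e : ℝ := lam (m 0) * lam (m 1) * (1 + if m = m ∘ Equiv.swap 0 1 then 1 else 0) with he
  have he0 : 0 ≤ e := mul_nonneg (mul_nonneg (hl _) (hl _)) (by positivity)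
  have hx : 0 < 1 + lam (m 0) + lam (m 1) := by linarith [hl (m 0), hl (m 1)]
  rw [lintegral_prod_norm_sq_diagScrooge (a := 0) hl hD]
  have h1 := lintegral_Ioi_exp (c := 0) hx
  rw [zero_mul, neg_zero, Real.exp_zero] at h1
  rw [div_eq_mul_one_div, ENNReal.ofReal_mul he0, ← h1, ← lintegral_const_mul _ (by fun_prop)]
  refine setLIntegral_mono' measurableSet_Ioi fun t ht => ?_
  have ht0 : 0 < t := ht
  rw [← ENNReal.ofReal_mul he0]
  refine ENNReal.ofReal_le_ofReal ?_
  have hpos : ∀ j, 0 < 1 + lam j * t := fun j => by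
    have := mul_nonneg (hl j) ht0.le
    linarith
  have hle : ∀ j, 1 + lam j * t ≤ Real.exp (lam j * t) := fun j => by
    linarith [Real.add_one_le_exp (lam j * t)]
  change _ ≤ t ^ 0 / 0 ! * ∏ j, (lam j ^ (List.ofFn m).count j * ((List.ofFn m).count j)! /
    (1 + lam j * t) ^ ((List.ofFn m).count j + 1))
  have h3 := prod_comp_eq_prod_pow_count m lam
  have h4 := prod_comp_eq_prod_pow_count m fun j => 1 + lam j * t
  rw [Fin.prod_univ_two] at h3 h4
  simp only [pow_succ _ (List.count _ _), Finset.prod_div_distrib, Finset.prod_mul_distrib]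
  rw [← h3, ← h4, prod_factorial_count m, ← he, pow_zero, Nat.factorial_zero, Nat.cast_one, div_one,
    one_mul, div_eq_mul_inv]
  refine mul_le_mul_of_nonneg_left ?_ he0
  rw [Real.exp_neg]
  refine inv_anti₀ (mul_pos (mul_pos (hpos _) (hpos _)) (Finset.prod_pos fun j _ => hpos j)) ?_
  have h5 : ∏ j, (1 + lam j * t) ≤ Real.exp t := by
    calc ∏ j, (1 + lam j * t) ≤ ∏ j, Real.exp (lam j * t) :=
          Finset.prod_le_prod (fun j _ => (hpos j).le) fun j _ => hle j
      _ = Real.exp t := by rw [← Real.exp_sum, ← Finset.sum_mul, hs, one_mul]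
  calc (1 + lam (m 0) * t) * (1 + lam (m 1) * t) * ∏ j, (1 + lam j * t)
      ≤ Real.exp (lam (m 0) * t) * Real.exp (lam (m 1) * t) * Real.exp t :=
        mul_le_mul (mul_le_mul (hle _) (hle _) (hpos _).le (Real.exp_pos _).le) h5
          (Finset.prod_nonneg fun j _ => (hpos j).le) (by positivity)
    _ = Real.exp (t * (1 + lam (m 0) + lam (m 1))) := by
        rw [← Real.exp_add, ← Real.exp_add]
        congr 1
        ring

lemma sum_fin_two_arrow (f : Fin D → Fin D → ℝ) :
    ∑ m : Fin 2 → Fin D, f (m 0) (m 1) = ∑ i, ∑ j, f i j := by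
  rw [← Fintype.sum_prod_type', ← Equiv.sum_comp (finTwoArrowEquiv (Fin D))]
  rfl

lemma traceNorm_kthMoment_sub_le {ρ : Matrix (Fin D) (Fin D) ℂ} (hρ : IsDensityMatrix ρ) :
    traceNorm (kthMoment (scrooge ρ) 2 - tensorPow ρ 2 * (1 + swapOp D))
      ≤ 8 * (ρ * ρ).trace.re := by
  obtain ⟨s, lam, h⟩ := exists_eigenbasis hρ.1.isHermitian
  have hl := eigenvalue_nonneg hρ.1 h
  have hs := sum_eigenvalue hρ h
  have : IsFiniteMeasure (diagScrooge lam) := ⟨by rw [diagScrooge_univ hl hs]; simp⟩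
  set dE : (Fin 2 → Fin D) → ENNReal := fun m =>
    ∫⁻ z, ENNReal.ofReal (∏ i, ‖z (m i)‖ ^ 2) ∂diagScrooge lam with hdE
  set δ : (Fin 2 → Fin D) → ℝ := fun m => 1 + if m = m ∘ Equiv.swap 0 1 then 1 else 0 with hδ
  have hδ1 : ∀ m, 1 ≤ δ m := fun m => by
    simp only [hδ]
    split_ifs <;> norm_num
  have hδ2 : ∀ m, δ m ≤ 2 := fun m => by
    simp only [hδ]
    split_ifs <;> norm_num
  set e : (Fin 2 → Fin D) → ℝ := fun m => lam (m 0) * lam (m 1) * δ m with he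
  have he0 : ∀ m, 0 ≤ e m := fun m =>
    mul_nonneg (mul_nonneg (hl _) (hl _)) (zero_le_one.trans (hδ1 m))
  have hsumE : ∑ m, dE m = 1 := sum_lintegral_prod_norm_sq_diagScrooge hl hs 2
  have hfin : ∀ m, dE m ≠ ⊤ := fun m => by
    refine ne_top_of_le_ne_top ENNReal.one_ne_top ?_
    rw [← hsumE]
    exact Finset.single_le_sum (f := dE) (fun _ _ => zero_le) (Finset.mem_univ m)
  have hsum : ∑ m, (dE m).toReal = 1 := by
    rw [← ENNReal.toReal_sum fun m _ => hfin m, hsumE, ENNReal.toReal_one]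
  have hswap : ∀ m : Fin 2 → Fin D, dE (m ∘ Equiv.swap 0 1) = dE m := by
    intro m
    simp only [hdE, Function.comp_apply]
    congr 1
    funext z
    rw [Equiv.prod_comp (Equiv.swap 0 1) fun i => ‖z (m i)‖ ^ 2]
  have hδswap : ∀ m : Fin 2 → Fin D, δ (m ∘ Equiv.swap 0 1) = δ m := by
    intro m
    simp only [hδ, eq_comp_swap_iff, Function.comp_apply, Equiv.swap_apply_left,
      Equiv.swap_apply_right, eq_comm]
  have hnorm := traceNorm_of_matrixElement s
    (A := kthMoment (scrooge ρ) 2 - tensorPow ρ 2 * (1 + swapOp D))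
    (c := fun m => (dE m).toReal / δ m - lam (m 0) * lam (m 1)) (fun m => by
      simp only [hswap, hδswap, Function.comp_apply, Equiv.swap_apply_left, Equiv.swap_apply_right]
      ring) (by
      rw [Matrix.mul_sub, Matrix.sub_mul, conjTranspose_mul_kthMoment_scrooge_mul hρ.1 h,
        conjTranspose_mul_tensorPow_mul h, kthMoment_diagScrooge_two, ← Matrix.sub_mul,
        Matrix.diagonal_sub]
      congr 2
      funext m
      simp [hdE, hδ])
  -- With `d`, `e` the moment entry and its approximation, `x = λ_(m 0) + λ_(m 1)` and `d ≥ e (1 -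
  -- x)`, one has `|d - e| ≤ d - e + 2 e x`. Then `λλ ≤ e ≤ 2 λλ`, where `λλ = λ_(m 0) λ_(m 1)`,
  -- gives the factor 4. Summed over `m`, the first two terms cancel and the last gives `4 · 2 ∑
  -- λ_i²`.
  have hterm : ∀ m, |(dE m).toReal / δ m - lam (m 0) * lam (m 1)| * δ m
      ≤ (dE m).toReal - lam (m 0) * lam (m 1)
        + 4 * (lam (m 0) * lam (m 1) * (lam (m 0) + lam (m 1))) := by
    intro m
    have hp : 0 < δ m := zero_lt_one.trans_le (hδ1 m)
    have hll : 0 ≤ lam (m 0) * lam (m 1) := mul_nonneg (hl _) (hl _)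
    have hx0 : 0 ≤ lam (m 0) + lam (m 1) := add_nonneg (hl _) (hl _)
    have e1 : |(dE m).toReal / δ m - lam (m 0) * lam (m 1)| * δ m = |(dE m).toReal - e m| := by
      conv_lhs => rw [← abs_of_pos hp]
      rw [← abs_mul, abs_of_pos hp, sub_mul, div_mul_cancel₀ _ hp.ne']
    have hlow : e m / (1 + lam (m 0) + lam (m 1)) ≤ (dE m).toReal :=
      (ENNReal.ofReal_le_iff_le_toReal (hfin m)).1 (le_lintegral_diagScrooge hl hs m)
    have hlow2 : e m - e m * (lam (m 0) + lam (m 1)) ≤ e m / (1 + lam (m 0) + lam (m 1)) := by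
      rw [le_div_iff₀ (by linarith)]
      nlinarith [he0 m, mul_nonneg (he0 m) (mul_nonneg hx0 hx0)]
    have hee : e m * (lam (m 0) + lam (m 1))
        ≤ 2 * (lam (m 0) * lam (m 1) * (lam (m 0) + lam (m 1))) := by
      have := mul_le_mul_of_nonneg_left (hδ2 m) (mul_nonneg hll hx0)
      simp only [he]
      linarith
    have hel : lam (m 0) * lam (m 1) ≤ e m := le_mul_of_one_le_right hll (hδ1 m)
    rw [e1, abs_le']
    constructor
    · have := mul_nonneg hll hx0
      linarith
    · linarith
  have hs1 : ∑ m : Fin 2 → Fin D, lam (m 0) * lam (m 1) = 1 := by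
    rw [sum_fin_two_arrow fun i j => lam i * lam j, ← Finset.sum_mul_sum, hs, one_mul]
  have hs2 : ∑ m : Fin 2 → Fin D, lam (m 0) * lam (m 1) * (lam (m 0) + lam (m 1))
      = 2 * ∑ i, lam i ^ 2 := by
    rw [sum_fin_two_arrow fun i j => lam i * lam j * (lam i + lam j)]
    have : ∀ i j, lam i * lam j * (lam i + lam j) = lam i ^ 2 * lam j + lam i * lam j ^ 2 :=
      fun i j => by ring
    simp only [this, Finset.sum_add_distrib, ← Finset.sum_mul_sum]
    rw [hs]
    ring
  rw [hnorm, trace_mul_self_re h]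
  calc ∑ m, |(dE m).toReal / δ m - lam (m 0) * lam (m 1)| * δ m
      ≤ ∑ m, ((dE m).toReal - lam (m 0) * lam (m 1)
        + 4 * (lam (m 0) * lam (m 1) * (lam (m 0) + lam (m 1)))) :=
        Finset.sum_le_sum fun m _ => hterm m
    _ = 8 * ∑ i, lam i ^ 2 := by
        rw [Finset.sum_add_distrib, Finset.sum_sub_distrib, ← Finset.mul_sum, hsum, hs1, hs2]
        ring

end SecondMoment

end Scrooge

theorem mainTheorem6 :
    (∀ (D : ℕ) (ρ : Matrix (Fin D) (Fin D) ℂ) (_ : Scrooge.IsDensityMatrix ρ)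
      (s : OrthonormalBasis (Fin D) ℂ (EuclideanSpace ℂ (Fin D))) (lam : Fin D → ℝ)
      (_ : ∀ j, Matrix.toEuclideanLin ρ (s j) = (lam j : ℂ) • s j) (k : ℕ),
      -- nonzero matrix elements only between index tuples related by a permutation
      (∀ m m' : Fin k → Fin D,
        Scrooge.matrixElement s (Scrooge.kthMoment (Scrooge.scrooge ρ) k) m m' ≠ 0 →
          ∃ σ : Equiv.Perm (Fin k), m' = m ∘ σ) ∧
      -- the matrix elements do not depend on the permutation
      (∀ (m : Fin k → Fin D) (σ : Equiv.Perm (Fin k)),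
        Scrooge.matrixElement s (Scrooge.kthMoment (Scrooge.scrooge ρ) k) m (m ∘ σ) =
          Scrooge.matrixElement s (Scrooge.kthMoment (Scrooge.scrooge ρ) k) m m) ∧
      (2 ≤ k → ρ.PosDef → ∀ m : Fin k → Fin D,
        -- the closed form, for pairwise distinct eigenvalues
        (Function.Injective lam →
          Scrooge.matrixElement s (Scrooge.kthMoment (Scrooge.scrooge ρ) k) m m =
            (((-1) ^ D / ((k - 2)! : ℝ) * (∏ i, (lam i)⁻¹) *
              Scrooge.mixedPartial m (Scrooge.Lam k) (fun i => (lam i)⁻¹) : ℝ) : ℂ)) ∧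
        -- the closed form as a limit, for arbitrary (possibly repeated) eigenvalues
        Tendsto (fun μ : Fin D → ℝ =>
            (((-1) ^ D / ((k - 2)! : ℝ) * (∏ i, (lam i)⁻¹) *
              Scrooge.mixedPartial m (Scrooge.Lam k) μ : ℝ) : ℂ))
          (𝓝[{μ | Function.Injective μ}] (fun i => (lam i)⁻¹))
          (𝓝 (Scrooge.matrixElement s (Scrooge.kthMoment (Scrooge.scrooge ρ) k) m m)))) ∧
    -- the second moment for small purity, with a constant independent of `D` and `ρ`
    (∃ C : ℝ, ∀ (D : ℕ) (ρ : Matrix (Fin D) (Fin D) ℂ), Scrooge.IsDensityMatrix ρ →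
      Scrooge.traceNorm (Scrooge.kthMoment (Scrooge.scrooge ρ) 2 -
          Scrooge.tensorPow ρ 2 * (1 + Scrooge.swapOp D)) ≤ C * (ρ * ρ).trace.re) := by
  refine ⟨fun D ρ hρ s lam h k => ?_, 8, fun D ρ hρ => Scrooge.traceNorm_kthMoment_sub_le hρ⟩
  have hl := Scrooge.eigenvalue_nonneg hρ.1 h
  have hs := Scrooge.sum_eigenvalue hρ h
  have hD := Scrooge.pos_of_sum_eq_one hs
  have : IsFiniteMeasure (Scrooge.diagScrooge lam) :=
    ⟨by rw [Scrooge.diagScrooge_univ hl hs]; simp⟩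
  have hM : ∀ m m' : Fin k → Fin D,
      Scrooge.matrixElement s (Scrooge.kthMoment (Scrooge.scrooge ρ) k) m m'
        = Scrooge.kthMoment (Scrooge.diagScrooge lam) k m m' := fun m m' => by
    rw [Scrooge.matrixElement_eq, Scrooge.conjTranspose_mul_kthMoment_scrooge_mul hρ.1 h]
  refine ⟨fun m m' h0 => ?_, fun m σ => ?_, fun hk hpd m => ?_⟩
  · rw [hM] at h0
    exact Scrooge.exists_perm_of_kthMoment_ne_zero h0
  · rw [hM, hM, Scrooge.kthMoment_diagScrooge_perm]
  obtain ⟨a, rfl⟩ : ∃ a, k = a + 2 := ⟨k - 2, by omega⟩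
  have hlpos := Scrooge.eigenvalue_pos hpd h
  have hipos : ∀ i, 0 < (lam i)⁻¹ := fun i => inv_pos.2 (hlpos i)
  have hsign : ((-1 : ℝ) ^ D) * (-1) ^ D = 1 := by rw [← mul_pow]; simp
  have hformula : ∀ μ ∈ Scrooge.distinctPos D,
      (((-1) ^ D / ((a + 2 - 2)! : ℝ) * (∏ i, (lam i)⁻¹) *
        Scrooge.mixedPartial m (Scrooge.Lam (a + 2)) μ : ℝ) : ℂ)
      = ((1 / (a ! : ℝ) * (∏ i, (lam i)⁻¹) *
        Scrooge.resolventIntegral a (fun i => (List.ofFn m).count i) μ : ℝ) : ℂ) := by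
    intro μ hμ
    rw [Scrooge.mixedPartial_Lam hD a m hμ, add_tsub_cancel_right]
    congr 1
    linear_combination (1 / (a ! : ℝ) * (∏ i, (lam i)⁻¹) *
      Scrooge.resolventIntegral a (fun i => (List.ofFn m).count i) μ) * hsign
  rw [hM, Scrooge.kthMoment_diagScrooge_of_pos hlpos hD]
  refine ⟨fun hinj => (hformula _ ⟨fun i j hij => hinj (inv_injective hij), hipos⟩).symm, ?_⟩
  have hcont := Scrooge.continuousAt_resolventIntegral hD a (Scrooge.sum_count_ofFn m) hipos
  refine Tendsto.congr' ?_ ((Complex.continuous_ofReal.continuousAt.tendsto.comp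
    (hcont.tendsto.const_mul (1 / (a ! : ℝ) * ∏ i, (lam i)⁻¹))).mono_left nhdsWithin_le_nhds)
  -- The punctured filter only supplies distinct coordinates; positivity holds near the positive
  -- point `λ⁻¹` by openness.
  filter_upwards [self_mem_nhdsWithin,
    mem_nhdsWithin_of_mem_nhds (Scrooge.isOpen_setOf_pos.mem_nhds hipos)] with μ h1 h2
  exact (hformula μ ⟨h1, h2⟩).symm
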